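/- Let $I\subseteq\mathbb R$ and $Q\subseteq\mathbb R^3$ be open. Let $\varphi:\mathbb R\times\mathbb R^3\to\mathbb R$ and $u:\mathbb R\times\mathbb R^3\to\mathbb R^3$ be $C^\infty$ on $I\times Q$ and satisfy the transport equation $\varphi_t+u\cdot\nabla\varphi=0$ on $I\times Q$. Assume that for every $t\in I$ the zero level set $\{\varphi(t,\cdot)=0\}$ is contained in $Q$ and that $\nabla\varphi(t,\cdot)\neq0$ on it. Assume also that every $t\in I$ admits a compact set $K\subset Q$ and a $\delta>0$ such that $\{x\in Q:|\varphi(s,x)|\le\delta\}\subseteq K$ for all $s$ in a neighbourhood of $t$. (If $\varphi$ is smooth on $I\times\mathbb R^3$, this last assumption holds automatically when $Q$ is bounded and contains all the zero level sets.) Write $n=\nabla\varphi/|\nabla\varphi|$. Let $f[\varphi]$ be a density depending on $\varphi$ and finitely many of its space derivatives, that is $f[\varphi](t,x)=f\big(\varphi,D\varphi,\dots,D^{k+1}\varphi\big)(t,x)$, where $k\ge0$ and $f$ is $C^\infty$ on the set of jets with nonzero first-order part. Let $d\sigma$ denote surface area (normalized two-dimensional Hausdorff measure), and put $$J(t)=\int_{\{\varphi(t,\cdot)=0\}}f[\varphi]\,d\sigma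 .$$ Let $\zeta:\mathbb R\to[0,\infty)$ be continuous, with $\zeta=0$ outside $[-1,1]$ and $\int_{\mathbb R}\zeta=1$, and for $\varepsilon>0$ put $$J_\varepsilon(t)=\int_Q f[\varphi]\,|\nabla\varphi|\,\tfrac1\varepsilon\,\zeta\!\left(\tfrac{\varphi}{\varepsilon}\right)dx .$$ Then for every $t\in I$ the following hold. 1. (Shape derivative) The functions $f[\varphi]$ and $(f[\varphi])_t+\operatorname{div}(f[\varphi]n)\,u\cdot n$ are integrable on the surface $\{\varphi(t,\cdot)=0\}$, $J$ is differentiable at $t$, and $$J'(t)=\int_{\{\varphi(t,\cdot)=0\}}\Big((f[\varphi])_t+\operatorname{div}(f[\varphi]\,n)\,u\cdot n\Big)\,d\sigma .$$ 2. (Surface Reynolds formula) With $\operatorname{div}_{\partial\Omega}u=\operatorname{div}u-([\nabla u]n)\cdot n$, one also has $$J'(t)=\int_{\{\varphi(t,\cdot)=0\}}\Big((f[\varphi])_t+u\cdot\nabla f[\varphi]+f[\varphi]\operatorname{div}_{\partial\Omega}u\Big)\,d\sigma ,$$ with integrable integrand. 3. (Exact derivative of the regularized functional) For all sufficiently small $\varepsilon>0$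 and all $s$ in a neighbourhood (which may depend on $\varepsilon$) of $t$, the integrands below and in $J_\varepsilon(s)$ are integrable on $Q$, $J_\varepsilon$ is differentiable at $s$, and $$J_\varepsilon'(s)=\int_Q\Big((f[\varphi])_t+\operatorname{div}(f[\varphi]\,n)\,u\cdot n\Big)|\nabla\varphi|\,\tfrac1\varepsilon\,\zeta\!\left(\tfrac{\varphi}{\varepsilon}\right)dx ,$$ where the integrand is evaluated at time $s$. 4. (Limit) As $\varepsilon\to0^+$, one has $J_\varepsilon(t)\to J(t)$ and $J_\varepsilon'(t)\to J'(t)$, and the right-hand side in 3 at $s=t$ converges to the right-hand side in 1. -/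

import Mathlib

open MeasureTheory Filter Set
open scoped Topology ContDiff Gradient

namespace LevelSetShape

noncomputable section

/-- Three-dimensional Euclidean space. -/
abbrev E3 : Type := EuclideanSpace ℝ (Fin 3)

/-- Jets of order `k + 1` of real functions at a point of `ℝ³`: a value together with the
(multilinear) derivatives of orders `1, …, k + 1`. -/
abbrev Jet (k : ℕ) : Type := (i : Fin (k + 2)) → ContinuousMultilinearMap ℝ (fun _ : Fin (i : ℕ) => E3) ℝ

/-- The jet of `ψ` at `x`: `(ψ(x), Dψ(x), …, D^{k+1}ψ(x))`. -/
def jet (k : ℕ) (ψ : E3 → ℝ) (x : E3) : Jet k := fun i => iteratedFDeriv ℝ (i : ℕ) ψ x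

/-- The jets whose first-order part is nonzero, that is, the jets of functions with `∇ψ(x) ≠ 0`. -/
def regularJets (k : ℕ) : Set (Jet k) := {j | j 1 ≠ 0}

/-- The density `f[ψ]`: the function `f` of `ψ` and its derivatives, evaluated at `x`. -/
def density {k : ℕ} (f : Jet k → ℝ) (ψ : E3 → ℝ) (x : E3) : ℝ := f (jet k ψ x)

/-- The unit normal `n = ∇ψ / |∇ψ|` to the level sets of `ψ`. -/
def normal (ψ : E3 → ℝ) (x : E3) : E3 := ‖∇ ψ x‖⁻¹ • ∇ ψ x

/-- The divergence `∑ᵢ ∂ᵢ vᵢ` of a vector field. -/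
def divergence (v : E3 → E3) (x : E3) : ℝ :=
  ∑ i : Fin 3, fderiv ℝ v x (EuclideanSpace.single i 1) i

/-- The tangential divergence `div v - ([∇v] n) · n` with respect to the level sets of `ψ`. -/
def tangentialDivergence (ψ : E3 → ℝ) (v : E3 → E3) (x : E3) : ℝ :=
  divergence v x - inner ℝ (fderiv ℝ v x (normal ψ x)) (normal ψ x)

/-- The surface integral `∫_{ψ = 0} g dσ`, where `dσ` is the area measure, that is, the
two-dimensional Hausdorff measure normalized so as to agree with Lebesgue measure on planes. -/
def surfaceIntegral (ψ : E3 → ℝ) (g : E3 → ℝ) : ℝ :=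
  ∫ x in {x | ψ x = 0}, g x ∂(μHE[2] : Measure E3)

/-- Integrability on the surface `{ψ = 0}` with respect to area. -/
def SurfaceIntegrable (ψ : E3 → ℝ) (g : E3 → ℝ) : Prop :=
  IntegrableOn g {x | ψ x = 0} (μHE[2] : Measure E3)

/-- The weight `|∇ψ| (1/ε) ζ(ψ/ε)` of the volumic approximation. -/
def weight (ζ : ℝ → ℝ) (ε : ℝ) (ψ : E3 → ℝ) (x : E3) : ℝ :=
  ‖∇ ψ x‖ * (ε⁻¹ * ζ (ψ x / ε))

/-- The functional `J(ψ) = ∫_{ψ = 0} f[ψ] dσ`. -/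
def J {k : ℕ} (f : Jet k → ℝ) (ψ : E3 → ℝ) : ℝ := surfaceIntegral ψ (density f ψ)

/-- The regularized functional `J_ε(ψ) = ∫_Q f[ψ] |∇ψ| (1/ε) ζ(ψ/ε) dx`. -/
def Jreg {k : ℕ} (f : Jet k → ℝ) (Q : Set E3) (ζ : ℝ → ℝ) (ε : ℝ) (ψ : E3 → ℝ) : ℝ :=
  ∫ x in Q, density f ψ x * weight ζ ε ψ x

/-- The time derivative `(f[φ])_t` at a fixed point `x`. -/
def densityDt {k : ℕ} (f : Jet k → ℝ) (φ : ℝ → E3 → ℝ) (t : ℝ) (x : E3) : ℝ :=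
  deriv (fun s => density f (φ s) x) t

/-- The integrand `(f[φ])_t + div(f[φ] n) u · n`. -/
def shapeIntegrand {k : ℕ} (f : Jet k → ℝ) (φ : ℝ → E3 → ℝ) (u : ℝ → E3 → E3)
    (t : ℝ) (x : E3) : ℝ :=
  densityDt f φ t x +
    divergence (fun y => density f (φ t) y • normal (φ t) y) x * inner ℝ (u t x) (normal (φ t) x)

/-- The integrand `(f[φ])_t + u · ∇ f[φ] + f[φ] div_{∂Ω} u` of the surface Reynolds formula. -/
def reynoldsIntegrand {k : ℕ} (f : Jet k → ℝ) (φ : ℝ → E3 → ℝ) (u : ℝ → E3 → E3)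
    (t : ℝ) (x : E3) : ℝ :=
  densityDt f φ t x + inner ℝ (u t x) (∇ (density f (φ t)) x) +
    density f (φ t) x * tangentialDivergence (φ t) (u t) x

end

end LevelSetShape

open LevelSetShape

/-!
The proof compares the surface integral over `{ψ = 0}` with volume integrals against the kernel
`|∇ψ| ε⁻¹ ζ(ψ/ε)`, whose time derivative can be computed by integration by parts.

*The static limit.* For `g` continuous with compact support where `ψ` is `C¹` and `∇ψ ≠ 0`,
`∫ g |∇ψ| ε⁻¹ ζ(ψ/ε) dx → ∫_{ψ = 0} g dσ` (`tendsto_integral_weight`). For an affine `ψ` this is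
Fubini's theorem and an approximate identity on the line (`tendsto_integral_plane`). In general,
for every `K > 1` and near every point there is a change of variables, `K`-bilipschitz in both
directions, taking `ψ` to an affine function (`exists_straightening`). A `K`-Lipschitz map increases
`d`-dimensional Hausdorff measure at most by the factor `K ^ d`, so both sides are known up to a
power of `K`; this is `AsymptoticallyComparable`. A partition of unity globalizes the comparison
for each fixed `K`, and then `K → 1`. No area or coarea formula is needed.

*Time derivative of the regularized integral.* Let `n = ∇φ/|∇φ|`, let `Z' = ζ`, and let `χ` be a
cut-off equal to `1` near the level sets. Since `∇(Z(φ/ε)) = ε⁻¹ ζ(φ/ε) ∇φ`, the divergence theorem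
gives `∫ χ a |∇φ| ε⁻¹ ζ(φ/ε) = -∫ div(χ a n) Z(φ/ε)`. The right-hand side can be differentiated in
time although `ζ` is only continuous. Integrating by parts once more, with `n_t ⊥ n` and
`φ_t = -|∇φ| u · n`, the derivative is the same kind of integral with `a` replaced by
`D a = a_t + div(a n) u · n` (`hasDerivAt_integral_cutoff_mul_weight`).

*Time derivative of the surface integral.* As `D a` is again smooth, the rule applies twice: the
second time derivative of the regularized integral of `a` is the regularized integral of `D (D a)`,
and that one equals `-∫ div(χ D(D a) n) Z(φ/ε)`, which is bounded uniformly in `ε`. Hence the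
regularized integrals satisfy a second order Taylor estimate uniform in `ε`, and pointwise limits
in `ε` suffice to differentiate the limit
(`hasDerivAt_of_tendsto_of_second_deriv_bound`, `hasDerivAt_surfaceIntegral_cutoff`).

*Reynolds formula.* The difference of the two integrands, times `|∇φ|`, is the divergence of the
field `a |∇φ| (u - (u · n) n)`, which is tangent to the level sets (`divergence_tangentialFlux`).
Multiplied by a smooth kernel in `φ` such a divergence has integral zero, so the static limit shows
that the two surface integrals agree (`surfaceIntegral_reynoldsRate_eq`).
-/

namespace LevelSetShape

section LevelSetLimit

open scoped ENNReal NNReal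

/-! ### The limit for planes -/

open Metric Bornology in
/-- The functions `ε⁻¹ ζ(·/ε)` form an approximate identity at `0`. -/
theorem tendsto_integral_rescaled {ζ : ℝ → ℝ} (hζ0 : ∀ r, 0 ≤ ζ r)
    (hζsupp : Function.support ζ ⊆ Icc (-1) 1) (hζ1 : ∫ r, ζ r = 1)
    {G : ℝ → ℝ} (hG : Integrable G) (hGc : Continuous G) :
    Tendsto (fun ε => ∫ r, G r * (ε⁻¹ * ζ (r / ε))) (𝓝[>] 0) (𝓝 (G 0)) := by
  have h := tendsto_integral_comp_smul_smul_of_integrable (μ := volume) hζ0 hζ1 (by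
    refine tendsto_const_nhds.congr' ?_
    have : ∀ᶠ x : ℝ in cobounded ℝ, x ∉ closedBall (0 : ℝ) 1 := isBounded_closedBall
    filter_upwards [this] with x hx
    have : ζ x = 0 := by
      by_contra h
      refine hx ?_
      rw [Real.closedBall_eq_Icc]
      simpa using hζsupp h
    rw [this, mul_zero]) hG hGc.continuousAt
  refine (h.comp tendsto_inv_nhdsGT_zero).congr fun ε => ?_
  refine integral_congr_ae (Eventually.of_forall fun r => ?_)
  simp [div_eq_inv_mul, mul_comm]

/-- Volume on `ℝ³` is the product of length along the unit vector `e` and area on `eᗮ`. -/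
theorem measurePreserving_line_prod (p e : E3) (he : ‖e‖ = 1) :
    MeasurePreserving (fun q : ℝ × (ℝ ∙ e)ᗮ => q.1 • e + (q.2 : E3) + p) := by
  have h1 := ((ℝ ∙ e).measurePreserving_measurableEquivProd p).symm
  have h2 := (LinearIsometryEquiv.toSpanUnitSingleton (𝕜 := ℝ) e he).measurePreserving
  have h3 := h1.comp (h2.prod (MeasurePreserving.id (volume : Measure (ℝ ∙ e)ᗮ)))
  rw [InnerProductSpace.euclideanHausdorffMeasure_eq_volume] at h3
  convert h3 using 1
  · ext q : 1
    simp [LinearIsometryEquiv.toSpanUnitSingleton_apply]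
  · exact Measure.volume_eq_prod _ _

theorem finrank_orthogonal_line {e : E3} (he : ‖e‖ = 1) : Module.finrank ℝ (ℝ ∙ e)ᗮ = 2 := by
  have h := (ℝ ∙ e).finrank_add_finrank_orthogonal
  have h0 : e ≠ 0 := by rintro rfl; simp at he
  rw [finrank_span_singleton h0] at h
  simp at h
  omega

/-- The area measure on the plane through `p` orthogonal to `e` is Lebesgue measure on `eᗮ`,
transported by the isometry `v ↦ v + p`. -/
theorem integrableOn_and_setIntegral_plane_eq (p e : E3) (he : ‖e‖ = 1) (g : E3 → ℝ)
    (hg : Continuous g)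
    (hgc : HasCompactSupport g) :
    IntegrableOn g {y | inner ℝ e (y - p) = 0} (μHE[2] : Measure E3) ∧
    ∫ y in {y | inner ℝ e (y - p) = 0}, g y ∂(μHE[2] : Measure E3) =
      ∫ v : (ℝ ∙ e)ᗮ, g (v + p) := by
  let ι : (ℝ ∙ e)ᗮ → E3 := fun v => (v : E3) + p
  have hι : Isometry ι := (IsometryEquiv.addRight p).isometry.comp isometry_subtype_coe
  have hr : Set.range ι = {y | inner ℝ e (y - p) = 0} := by
    ext y
    constructor
    · rintro ⟨v, rfl⟩
      simpa [ι] using Submodule.mem_orthogonal_singleton_iff_inner_right.1 v.2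
    · intro hy
      exact ⟨⟨y - p, Submodule.mem_orthogonal_singleton_iff_inner_right.2 hy⟩, by simp [ι]⟩
  have hm : (μHE[2] : Measure E3).restrict {y | inner ℝ e (y - p) = 0} = volume.map ι := by
    rw [← hr, ← hι.map_euclideanHausdorffMeasure,
      ← InnerProductSpace.euclideanHausdorffMeasure_eq_volume, finrank_orthogonal_line he]
  have hemb : MeasurableEmbedding ι := hι.isClosedEmbedding.measurableEmbedding
  rw [IntegrableOn, hm, hemb.integrable_map_iff, hemb.integral_map]
  exact ⟨(hg.comp hι.continuous).integrable_of_hasCompactSupport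
    (hgc.comp_isClosedEmbedding hι.isClosedEmbedding), rfl⟩

/-- The static limit when the level set function is `y ↦ e · (y - p)` with `e` a unit vector. -/
theorem tendsto_integral_plane {ζ : ℝ → ℝ} (hζ0 : ∀ r, 0 ≤ ζ r) (hζ : Continuous ζ)
    (hζsupp : Function.support ζ ⊆ Icc (-1) 1) (hζ1 : ∫ r, ζ r = 1)
    (p e : E3) (he : ‖e‖ = 1) (g : E3 → ℝ) (hg : Continuous g) (hgc : HasCompactSupport g) :
    Tendsto (fun ε => ∫ y, g y * (ε⁻¹ * ζ (inner ℝ e (y - p) / ε))) (𝓝[>] 0)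
      (𝓝 (∫ y in {y | inner ℝ e (y - p) = 0}, g y ∂(μHE[2] : Measure E3))) := by
  let Φ : ℝ × (ℝ ∙ e)ᗮ → E3 := fun q => q.1 • e + (q.2 : E3) + p
  have hΦ : MeasurePreserving Φ := measurePreserving_line_prod p e he
  have hΦc : Continuous Φ := by fun_prop
  have hinner : ∀ q, inner ℝ e (Φ q - p) = q.1 := fun q => by
    simp [Φ, inner_add_right, inner_smul_right, he,
      Submodule.mem_orthogonal_singleton_iff_inner_right.1 q.2.2]
  have hproj : ∀ q, (ℝ ∙ e)ᗮ.orthogonalProjectionOnto (Φ q - p) = q.2 := fun q => by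
    have : (ℝ ∙ e)ᗮ.orthogonalProjectionOnto e = 0 := by
      rw [Submodule.orthogonalProjectionOnto_eq_zero_iff]
      simp
    simp [Φ, this]
  let G : ℝ → ℝ := fun r => ∫ v : (ℝ ∙ e)ᗮ, g (Φ (r, v))
  have hGc : Continuous G := by
    have hk : IsCompact ((fun y => (ℝ ∙ e)ᗮ.orthogonalProjectionOnto (y - p)) '' tsupport g) :=
      hgc.isCompact.image (by fun_prop)
    rw [← continuousOn_univ]
    refine continuousOn_integral_of_compact_support hk
      (f := fun r v => g (Φ (r, v))) (by fun_prop) ?_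
    intro r v _ hv
    by_contra h
    exact hv ⟨Φ (r, v), subset_tsupport _ h, hproj (r, v)⟩
  have hint : Integrable (fun q => g (Φ q)) :=
    hΦ.integrable_comp_of_integrable (hg.integrable_of_hasCompactSupport hgc)
  have key := tendsto_integral_rescaled hζ0 hζsupp hζ1 hint.integral_prod_left hGc
  have h0 : G 0 = ∫ y in {y | inner ℝ e (y - p) = 0}, g y ∂(μHE[2] : Measure E3) := by
    rw [(integrableOn_and_setIntegral_plane_eq p e he g hg hgc).2]
    simp [G, Φ]
  rw [← h0]
  refine key.congr fun ε => ?_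
  have hc : Continuous (fun y => g y * (ε⁻¹ * ζ (inner ℝ e (y - p) / ε))) := by
    fun_prop
  have hi : Integrable (fun y => g y * (ε⁻¹ * ζ (inner ℝ e (y - p) / ε))) :=
    hc.integrable_of_hasCompactSupport hgc.mul_right
  have hcv : ∫ y, g y * (ε⁻¹ * ζ (inner ℝ e (y - p) / ε)) =
      ∫ q, g (Φ q) * (ε⁻¹ * ζ (inner ℝ e (Φ q - p) / ε)) := by
    conv_lhs => rw [← hΦ.map_eq]
    exact integral_map hΦ.aemeasurable hc.aestronglyMeasurable
  rw [hcv]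
  refine Eq.trans ?_ (integral_prod _ (hΦ.integrable_comp_of_integrable hi)).symm
  simp only [Function.comp_apply, hinner, integral_mul_const]

/-! ### Asymptotic comparability -/

/-- As `ε → 0⁺`, the family `V ε` is comparable up to the factor `c` with a family having a finite
limit `L`, and `L` is comparable with `s` up to the same factor. This does not presuppose that
`V` converges, it is stable under finite sums, and if it holds for `c` arbitrarily close to `1`
it gives `V ε → s`. -/
def AsymptoticallyComparable (c : ℝ≥0∞) (V : ℝ → ℝ≥0∞) (s : ℝ≥0∞) : Prop :=
  ∃ (A : ℝ → ℝ≥0∞) (L : ℝ≥0∞), L ≠ ⊤ ∧ Tendsto A (𝓝[>] 0) (𝓝 L) ∧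
    (∀ᶠ ε in 𝓝[>] (0 : ℝ), V ε ≤ c * A ε ∧ A ε ≤ c * V ε) ∧ s ≤ c * L ∧ L ≤ c * s

theorem AsymptoticallyComparable.sum {ι : Type*} {c : ℝ≥0∞} {V : ι → ℝ → ℝ≥0∞} {s : ι → ℝ≥0∞}
    (S : Finset ι) (h : ∀ i ∈ S, AsymptoticallyComparable c (V i) (s i)) :
    AsymptoticallyComparable c (fun ε => ∑ i ∈ S, V i ε) (∑ i ∈ S, s i) := by
  classical
  induction S using Finset.induction_on with
  | empty => exact ⟨0, 0, by simp, tendsto_const_nhds, by simp, by simp, by simp⟩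
  | insert i S hi ih =>
    obtain ⟨A, L, hL, hA, hV, h1, h2⟩ := ih fun j hj => h j (Finset.mem_insert_of_mem hj)
    obtain ⟨A', L', hL', hA', hV', h1', h2'⟩ := h i (Finset.mem_insert_self i S)
    simp only [Finset.sum_insert hi]
    refine ⟨fun ε => A' ε + A ε, L' + L, by simp [hL, hL'], hA'.add hA, ?_, ?_, ?_⟩
    · filter_upwards [hV, hV'] with ε h h'
      rw [mul_add, mul_add]
      exact ⟨add_le_add h'.1 h.1, add_le_add h'.2 h.2⟩
    · rw [mul_add]; exact add_le_add h1' h1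
    · rw [mul_add]; exact add_le_add h2' h2

theorem tendsto_of_asymptoticallyComparable {V : ℝ → ℝ≥0∞} {s : ℝ≥0∞} (n : ℕ)
    (h : ∀ K : ℝ≥0, 1 < K → AsymptoticallyComparable ((K : ℝ≥0∞) ^ n) V s) :
    s ≠ ⊤ ∧ Tendsto V (𝓝[>] 0) (𝓝 s) := by
  have hs : s ≠ ⊤ := by
    obtain ⟨A, L, hL, -, -, h1, -⟩ := h 2 (by norm_num)
    exact ne_top_of_le_ne_top (ENNReal.mul_ne_top (by simp) hL) h1
  have hlim : ∀ a : ℝ≥0∞, a ≠ ⊤ →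
      Tendsto (fun K : ℝ≥0 => (K : ℝ≥0∞) ^ n * ((K : ℝ≥0∞) ^ n * a)) (𝓝[>] 1) (𝓝 a) := by
    intro a ha
    lift a to ℝ≥0 using ha
    have : Continuous (fun K : ℝ≥0 => K ^ n * (K ^ n * a)) := by fun_prop
    have h1 : Tendsto (fun K : ℝ≥0 => K ^ n * (K ^ n * a)) (𝓝[>] 1) (𝓝 a) := by
      simpa using (this.tendsto 1).mono_left nhdsWithin_le_nhds
    exact_mod_cast ENNReal.tendsto_coe.2 h1
  refine ⟨hs, tendsto_order.2 ⟨fun a ha => ?_, fun b hb => ?_⟩⟩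
  · obtain ⟨K, hKa, hK⟩ := (((hlim a ha.ne_top).eventually (gt_mem_nhds ha)).and
      self_mem_nhdsWithin).exists
    have hK0 : (K : ℝ≥0∞) ^ n ≠ 0 := by
      have : K ≠ 0 := (zero_lt_one.trans hK).ne'
      simp [this]
    have hKt : (K : ℝ≥0∞) ^ n ≠ ⊤ := by simp
    obtain ⟨A, L, hL, hA, hV, h1, -⟩ := h K hK
    have hlt : (K : ℝ≥0∞) ^ n * a < L :=
      (ENNReal.mul_lt_mul_iff_right hK0 hKt).1 (hKa.trans_le h1)
    filter_upwards [hV, hA.eventually (lt_mem_nhds hlt)] with ε hε hAε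
    exact (ENNReal.mul_lt_mul_iff_right hK0 hKt).1 (hAε.trans_le hε.2)
  · obtain ⟨K, hKb, hK⟩ := (((hlim s hs).eventually (gt_mem_nhds hb)).and
      self_mem_nhdsWithin).exists
    have hKt : (K : ℝ≥0∞) ^ n ≠ ⊤ := by simp
    obtain ⟨A, L, hL, hA, hV, -, h2⟩ := h K hK
    have hlt : (K : ℝ≥0∞) ^ n * L < b := (by gcongr : _ ≤ _).trans_lt hKb
    filter_upwards [hV, (ENNReal.Tendsto.const_mul hA (Or.inr hKt)).eventually
      (gt_mem_nhds hlt)] with ε hε hAε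
    exact hε.1.trans_lt hAε

/-! ### Bilipschitz straightening of a level set -/

theorem euclideanHausdorffMeasure_image_le_of_lipschitzOnWith {f : E3 → E3} {K : ℝ≥0}
    {s t : Set E3} (hf : LipschitzOnWith K f s) (d : ℕ) (ht : t ⊆ s) :
    (μHE[d] : Measure E3) (f '' t) ≤ (K : ℝ≥0∞) ^ d * (μHE[d] : Measure E3) t := by
  simp only [Measure.euclideanHausdorffMeasure_def, Measure.smul_apply, ENNReal.smul_def,
    smul_eq_mul]
  have := (hf.mono ht).hausdorffMeasure_image_le (d := d) (by positivity)
  rw [ENNReal.rpow_natCast] at this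
  calc _ ≤ _ := mul_le_mul_right this _
    _ = _ := by ring

/-- Integrals for `d`-dimensional measure change at most by the factor `K ^ d` under a homeomorphism
which is `K`-Lipschitz together with its inverse. -/
theorem setLIntegral_comp_comparable (T : OpenPartialHomeomorph E3 E3) {K : ℝ≥0}
    (hT : LipschitzOnWith K T T.source) (hT' : LipschitzOnWith K T.symm T.target) (d : ℕ)
    {A : Set E3} (hA : MeasurableSet (T.source ∩ A)) {h : E3 → ℝ≥0∞} (hh : Measurable h) :
    ∫⁻ x in T.source ∩ A, h (T x) ∂(μHE[d] : Measure E3) ≤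
      (K : ℝ≥0∞) ^ d * ∫⁻ y in T.target ∩ T.symm ⁻¹' A, h y ∂(μHE[d] : Measure E3) ∧
    ∫⁻ y in T.target ∩ T.symm ⁻¹' A, h y ∂(μHE[d] : Measure E3) ≤
      (K : ℝ≥0∞) ^ d * ∫⁻ x in T.source ∩ A, h (T x) ∂(μHE[d] : Measure E3) := by
  have hTm : AEMeasurable T ((μHE[d] : Measure E3).restrict (T.source ∩ A)) :=
    (T.continuousOn.mono inter_subset_left).aemeasurable hA
  have him : ∀ B : Set E3, T '' (T ⁻¹' B ∩ (T.source ∩ A)) = B ∩ (T.target ∩ T.symm ⁻¹' A) := by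
    intro B
    ext y
    constructor
    · rintro ⟨x, ⟨hx, hxs, hxA⟩, rfl⟩
      exact ⟨hx, T.map_source hxs, by simpa [T.left_inv hxs] using hxA⟩
    · rintro ⟨hy, hyt, hyA⟩
      exact ⟨T.symm y, ⟨by simpa [T.right_inv hyt] using hy, T.map_target hyt, hyA⟩,
        T.right_inv hyt⟩
  have him' : ∀ B : Set E3,
      T.symm '' (B ∩ (T.target ∩ T.symm ⁻¹' A)) = T ⁻¹' B ∩ (T.source ∩ A) := by
    intro B
    rw [← him, image_image]
    refine (image_congr fun x hx => T.left_inv hx.2.1).trans (image_id' _)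
  rw [← lintegral_map' hh.aemeasurable hTm, ← smul_eq_mul, ← smul_eq_mul,
    ← lintegral_smul_measure, ← lintegral_smul_measure]
  constructor
  · refine lintegral_mono' (Measure.le_iff.2 fun B hB => ?_) le_rfl
    rw [Measure.map_apply_of_aemeasurable hTm hB, Measure.restrict_apply' hA, Measure.smul_apply,
      Measure.restrict_apply hB, ← him' B]
    exact euclideanHausdorffMeasure_image_le_of_lipschitzOnWith hT' d fun y hy => hy.2.1
  · refine lintegral_mono' (Measure.le_iff.2 fun B hB => ?_) le_rfl
    rw [Measure.smul_apply, Measure.map_apply_of_aemeasurable hTm hB, Measure.restrict_apply' hA,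
      Measure.restrict_apply hB, ← him B]
    exact euclideanHausdorffMeasure_image_le_of_lipschitzOnWith hT d fun y hy => hy.2.1

/-- Near a regular point, a homeomorphism that is `K`-Lipschitz in both directions takes the level
sets of `ψ` to parallel planes. The map is `x ↦ x + (ψ x / m - e · (x - x₀)) e`, where
`∇ψ x₀ = m e`; its strict derivative at `x₀` is the identity. -/
theorem exists_straightening {Ω : Set E3} (hΩ : IsOpen Ω) {ψ : E3 → ℝ} (hψ : ContDiffOn ℝ 1 ψ Ω)
    {x₀ : E3} (hx₀ : x₀ ∈ Ω) (hreg : ∇ ψ x₀ ≠ 0) {K : ℝ≥0} (hK : 1 < K) :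
    ∃ (m : ℝ) (e : E3) (T : OpenPartialHomeomorph E3 E3), 0 < m ∧ ‖e‖ = 1 ∧ x₀ ∈ T.source ∧
      T.source ⊆ Ω ∧ LipschitzOnWith K T T.source ∧ LipschitzOnWith K T.symm T.target ∧
      (∀ x ∈ T.source, ψ x = m * inner ℝ e (T x - x₀)) ∧
      ∀ x ∈ T.source, ‖∇ ψ x‖ ≤ K * m ∧ m ≤ K * ‖∇ ψ x‖ := by
  have hK0 : (0 : ℝ) < K := by exact_mod_cast zero_lt_one.trans hK
  have hK1 : (1 : ℝ) < K := by exact_mod_cast hK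
  set m : ℝ := ‖∇ ψ x₀‖ with hm
  have hm0 : 0 < m := norm_pos_iff.2 hreg
  set e : E3 := m⁻¹ • ∇ ψ x₀ with he
  have he1 : ‖e‖ = 1 := by
    rw [he, norm_smul, norm_inv, Real.norm_of_nonneg hm0.le, ← hm, inv_mul_cancel₀ hm0.ne']
  let T₀ : E3 → E3 := fun x => x + (m⁻¹ * ψ x - inner ℝ e (x - x₀)) • e
  have hψx : ContDiffAt ℝ 1 ψ x₀ := hψ.contDiffAt (hΩ.mem_nhds hx₀)
  have hfd : ∀ v, fderiv ℝ ψ x₀ v = m * inner ℝ e v := by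
    intro v
    rw [he, inner_smul_left, ← inner_gradient_left]
    simp [hm0.ne']
  have hT₀ : HasStrictFDerivAt T₀
      ((ContinuousLinearEquiv.refl ℝ E3 : E3 ≃L[ℝ] E3) : E3 →L[ℝ] E3) x₀ := by
    have h1 := hψx.hasStrictFDerivAt (by norm_num)
    have h2 : HasStrictFDerivAt (fun x : E3 => inner ℝ e (x - x₀)) (innerSL ℝ e) x₀ :=
      (innerSL ℝ e).hasStrictFDerivAt.comp x₀ ((hasStrictFDerivAt_id x₀).sub_const x₀)
    have h3 : HasStrictFDerivAt T₀ _ x₀ :=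
      (hasStrictFDerivAt_id x₀).add (((h1.const_mul m⁻¹).sub h2).smul_const e)
    refine h3.congr_fderiv ?_
    ext1 v
    simp [hfd, hm0.ne']
  -- `c` is chosen so that `(1 - c)⁻¹ = K`, and then `1 + c ≤ K` as well
  let c : ℝ≥0 := 1 - K⁻¹
  have hc0 : 0 < c := tsub_pos_of_lt (inv_lt_one_of_one_lt₀ hK)
  have hcr : (c : ℝ) = 1 - (K : ℝ)⁻¹ := by
    rw [NNReal.coe_sub (inv_lt_one_of_one_lt₀ hK).le]; simp
  have hcK : (1 + c : ℝ) ≤ K := by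
    rw [hcr]
    have : 0 ≤ (K - 1) ^ 2 * (K : ℝ)⁻¹ := by positivity
    have h2 : ((K : ℝ) - 1) ^ 2 * (K : ℝ)⁻¹ = K - 2 + (K : ℝ)⁻¹ := by field_simp; ring
    linarith
  obtain ⟨s, hs, hsT⟩ := hT₀.approximates_deriv_on_nhds (c := c) (Or.inr hc0)
  have hgrad : ContinuousAt (fun x => ‖∇ ψ x‖) x₀ := by
    have : ContinuousAt (fderiv ℝ ψ) x₀ :=
      (hψx.fderiv_right (m := 0) (by norm_num)).continuousAt
    exact (((InnerProductSpace.toDual ℝ E3).symm.continuous.continuousAt).comp this).norm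
  have hU : ∀ᶠ x in 𝓝 x₀, x ∈ s ∧ x ∈ Ω ∧ ‖∇ ψ x‖ ≤ K * m ∧ m ≤ K * ‖∇ ψ x‖ := by
    have h1 : m < K * m := by nlinarith
    have h2 : (K : ℝ)⁻¹ * m < m := by
      rw [inv_mul_lt_iff₀ hK0]; exact h1
    filter_upwards [hs, hΩ.mem_nhds hx₀, hgrad.eventually (gt_mem_nhds h1),
      hgrad.eventually (lt_mem_nhds h2)] with x h1 h2 h3 h4
    refine ⟨h1, h2, h3.le, ?_⟩
    rw [inv_mul_lt_iff₀ hK0] at h4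
    exact h4.le
  obtain ⟨U, hUs, hUo, hxU⟩ := eventually_nhds_iff.1 hU
  have hUT := hsT.mono_set fun x hx => (hUs x hx).1
  have hsymm : ‖((ContinuousLinearEquiv.refl ℝ E3 : E3 ≃L[ℝ] E3).symm : E3 →L[ℝ] E3)‖₊ = 1 := by
    rw [← NNReal.coe_inj]
    exact ContinuousLinearMap.norm_id
  have hcN : c < ‖((ContinuousLinearEquiv.refl ℝ E3 : E3 ≃L[ℝ] E3).symm : E3 →L[ℝ] E3)‖₊⁻¹ := by
    rw [hsymm, inv_one]
    exact tsub_lt_self one_pos (by simpa using zero_lt_one.trans hK)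
  let T := hUT.toOpenPartialHomeomorph T₀ U (Or.inr hcN) hUo
  have hTs : T.source = U := rfl
  have hTc : ∀ x, T x = T₀ x := fun x => rfl
  have hest : ∀ x ∈ U, ∀ y ∈ U, ‖T₀ x - T₀ y - (x - y)‖ ≤ c * ‖x - y‖ := fun x hx y hy => by
    simpa using hUT x hx y hy
  refine ⟨m, e, T, hm0, he1, hxU, fun x hx => (hUs x hx).2.1, ?_, ?_, ?_,
    fun x hx => (hUs x hx).2.2⟩
  · refine LipschitzOnWith.of_dist_le_mul fun x hx y hy => ?_
    rw [dist_eq_norm, dist_eq_norm, hTc, hTc]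
    have h1 := hest x hx y hy
    have h2 := norm_le_norm_add_norm_sub' (T₀ x - T₀ y) (x - y)
    nlinarith [norm_nonneg (x - y)]
  · refine LipschitzOnWith.of_dist_le_mul fun y hy z hz => ?_
    have h1 := hest _ (T.map_target hy) _ (T.map_target hz)
    rw [← hTc, ← hTc, T.right_inv hy, T.right_inv hz, hcr] at h1
    rw [dist_eq_norm, dist_eq_norm]
    have h2 := norm_le_norm_add_norm_sub (y - z) (T.symm y - T.symm z)
    have h3 : (K : ℝ)⁻¹ * ‖T.symm y - T.symm z‖ ≤ ‖y - z‖ := by linarith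
    rwa [inv_mul_le_iff₀ hK0] at h3
  · intro x _
    have hin : inner ℝ e e = (1 : ℝ) := by rw [real_inner_self_eq_norm_sq, he1]; norm_num
    have : T x - x₀ = (x - x₀) + (m⁻¹ * ψ x - inner ℝ e (x - x₀)) • e := by
      rw [hTc]; simp only [T₀]; abel
    rw [this, inner_add_right, inner_smul_right, hin]
    field_simp
    ring

/-! ### The limit for curved level sets -/

theorem lintegral_eq_setLIntegral_of_eq_zero {α : Type*} [MeasurableSpace α] {μ : Measure α}
    {S : Set α} (hS : MeasurableSet S) {f : α → ℝ≥0∞} (h : ∀ x ∉ S, f x = 0) :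
    ∫⁻ x, f x ∂μ = ∫⁻ x in S, f x ∂μ := by
  rw [← lintegral_indicator hS]
  congr 1
  exact (indicator_eq_self.2 fun x hx => by_contra fun hxS => hx (h x hxS)).symm

theorem measurableSet_inter_zeroLevel {Q : Set E3} (hQ : IsOpen Q) {ψ : E3 → ℝ}
    (hψ : ContinuousOn ψ Q) : MeasurableSet (Q ∩ {x | ψ x = 0}) := by
  have h1 := hψ.isOpen_inter_preimage hQ (isOpen_compl_singleton (x := (0 : ℝ)))
  convert hQ.measurableSet.diff h1.measurableSet using 1
  ext x
  by_cases h : ψ x = 0 <;> simp [h]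

theorem continuous_and_hasCompactSupport_indicator_comp_symm
    (T : OpenPartialHomeomorph E3 E3) {g : E3 → ℝ} (hg : Continuous g)
    (hgc : HasCompactSupport g) (hgT : tsupport g ⊆ T.source) :
    Continuous (T.target.indicator (g ∘ T.symm)) ∧
      HasCompactSupport (T.target.indicator (g ∘ T.symm)) := by
  have hK : IsCompact (T '' tsupport g) :=
    hgc.isCompact.image_of_continuousOn (T.continuousOn.mono hgT)
  have hzero : ∀ y ∉ T '' tsupport g, T.target.indicator (g ∘ T.symm) y = 0 := by
    intro y hy
    by_contra h
    have hyT : y ∈ T.target := mem_of_indicator_ne_zero h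
    rw [indicator_of_mem hyT] at h
    exact hy ⟨T.symm y, subset_tsupport _ h, T.right_inv hyT⟩
  have hc := HasCompactSupport.intro hK hzero
  have hts : tsupport (T.target.indicator (g ∘ T.symm)) ⊆ T.target := by
    have : tsupport (T.target.indicator (g ∘ T.symm)) ⊆ T '' tsupport g :=
      closure_minimal (fun y hy => by_contra fun h => hy (hzero y h)) hK.isClosed
    rintro y hy
    obtain ⟨x, hx, rfl⟩ := this hy
    exact T.map_source (hgT hx)
  refine ⟨ContinuousOn.continuous_of_tsupport_subset ?_ T.open_target hts, hc⟩
  refine (hg.comp_continuousOn T.continuousOn_symm).congr fun y hy => ?_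
  rw [indicator_of_mem hy]

/-- The static limit up to the factor `K ^ 4`, for functions supported near one point: straightening
costs `K ^ 3` for volume, `K` for `|∇ψ|`, and `K ^ 2` for area. -/
theorem exists_isOpen_asymptoticallyComparable {Ω : Set E3} (hΩ : IsOpen Ω) {ψ : E3 → ℝ}
    (hψ : ContDiffOn ℝ 1 ψ Ω) {x₀ : E3} (hx₀ : x₀ ∈ Ω) (hreg : ∇ ψ x₀ ≠ 0)
    {ζ : ℝ → ℝ} (hζ : Continuous ζ) (hζ0 : ∀ r, 0 ≤ ζ r)
    (hζsupp : Function.support ζ ⊆ Icc (-1) 1) (hζ1 : ∫ r, ζ r = 1) {K : ℝ≥0} (hK : 1 < K) :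
    ∃ U : Set E3, IsOpen U ∧ x₀ ∈ U ∧ ∀ g : E3 → ℝ, Continuous g → (∀ x, 0 ≤ g x) →
      HasCompactSupport g → tsupport g ⊆ U →
      AsymptoticallyComparable ((K : ℝ≥0∞) ^ 4)
        (fun ε => ∫⁻ x, ENNReal.ofReal (g x * weight ζ ε ψ x))
        (∫⁻ x in {x | ψ x = 0}, ENNReal.ofReal (g x) ∂(μHE[2] : Measure E3)) := by
  obtain ⟨m, e, T, hm, he, hxT, hTΩ, hT, hT', hψT, hgrad⟩ := exists_straightening hΩ hψ hx₀ hreg hK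
  have hK1 : (1 : ℝ≥0∞) ≤ K := by exact_mod_cast hK.le
  refine ⟨T.source, T.open_source, hxT, fun g hg hg0 hgc hgT => ?_⟩
  obtain ⟨hGc, hGs⟩ := continuous_and_hasCompactSupport_indicator_comp_symm T hg hgc hgT
  set G := T.target.indicator (g ∘ T.symm) with hG
  have hG0 : ∀ y, 0 ≤ G y := fun y => indicator_nonneg (fun z _ => hg0 _) y
  have hGT : ∀ x ∈ T.source, G (T x) = g x := fun x hx => by
    rw [hG, indicator_of_mem (T.map_source hx), Function.comp_apply, T.left_inv hx]
  have hGout : ∀ y ∉ T.target, G y = 0 := fun y hy => indicator_of_notMem hy _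
  have hgout : ∀ x ∉ T.source, g x = 0 := fun x hx =>
    by_contra fun h => hx (hgT (subset_tsupport _ h))
  let H : ℝ → E3 → ℝ := fun ε y => G y * (ε⁻¹ * ζ (inner ℝ e (y - x₀) / ε))
  have hHc : ∀ ε, Continuous (H ε) := fun ε => by fun_prop
  have hH0 : ∀ ε > 0, ∀ y, 0 ≤ H ε y := fun ε hε y =>
    mul_nonneg (hG0 y) (mul_nonneg (inv_nonneg.2 hε.le) (hζ0 _))
  obtain ⟨hLi, -⟩ := integrableOn_and_setIntegral_plane_eq x₀ e he G hGc hGs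
  have hAS : MeasurableSet (T.source ∩ {x | ψ x = 0}) :=
    measurableSet_inter_zeroLevel T.open_source (hψ.continuousOn.mono hTΩ)
  have hAT : T.target ∩ T.symm ⁻¹' {x | ψ x = 0} = T.target ∩ {y | inner ℝ e (y - x₀) = 0} := by
    ext y
    refine and_congr_right fun hy => ?_
    simp [hψT _ (T.map_target hy), T.right_inv hy, hm.ne']
  have hvol : (volume : Measure E3) = μHE[3] :=
    (EuclideanSpace.euclideanHausdorffMeasure_eq_volume 3).symm
  -- the straightened function is `m` times a distance, so the width `ε` becomes `ε / m`
  refine ⟨fun ε => ∫⁻ y, ENNReal.ofReal (H (ε / m) y),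
    ENNReal.ofReal (∫ y in {y | inner ℝ e (y - x₀) = 0}, G y ∂(μHE[2] : Measure E3)),
    ENNReal.ofReal_ne_top, ?_, ?_, ?_⟩
  · have hlim := tendsto_integral_plane hζ0 hζ hζsupp hζ1 x₀ e he G hGc hGs
    have hdiv : Tendsto (fun ε : ℝ => ε / m) (𝓝[>] 0) (𝓝[>] 0) := by
      refine tendsto_nhdsWithin_iff.2 ⟨?_, ?_⟩
      · simpa using ((tendsto_id (α := ℝ) (x := 𝓝 0)).div_const m).mono_left nhdsWithin_le_nhds
      · filter_upwards [self_mem_nhdsWithin] with ε hε using div_pos hε hm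
    refine (ENNReal.tendsto_ofReal (hlim.comp hdiv)).congr' ?_
    filter_upwards [self_mem_nhdsWithin] with ε hε
    exact ofReal_integral_eq_lintegral_ofReal
      ((hHc (ε / m)).integrable_of_hasCompactSupport hGs.mul_right)
      (Eventually.of_forall (hH0 _ (div_pos hε hm)))
  · filter_upwards [self_mem_nhdsWithin] with ε hε
    have hε : 0 < ε := hε
    have hw : ∀ x ∈ T.source, g x * weight ζ ε ψ x = ‖∇ ψ x‖ / m * H (ε / m) (T x) := by
      intro x hx
      simp only [H, hGT x hx, weight, hψT x hx]
      have : m * inner ℝ e (T x - x₀) / ε = inner ℝ e (T x - x₀) / (ε / m) := by field_simp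
      rw [this]
      field_simp
    have e1 : ∫⁻ x, ENNReal.ofReal (g x * weight ζ ε ψ x) =
        ∫⁻ x in T.source, ENNReal.ofReal (g x * weight ζ ε ψ x) :=
      lintegral_eq_setLIntegral_of_eq_zero T.open_source.measurableSet
        fun x hx => by simp [hgout x hx]
    have e2 : ∫⁻ y, ENNReal.ofReal (H (ε / m) y) = ∫⁻ y in T.target, ENNReal.ofReal (H (ε / m) y) :=
      lintegral_eq_setLIntegral_of_eq_zero T.open_target.measurableSet
        fun y hy => by simp [H, hGout y hy]
    obtain ⟨c1, c2⟩ := setLIntegral_comp_comparable T hT hT' 3 (A := univ)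
      (by simpa using T.open_source.measurableSet)
      (ENNReal.measurable_ofReal.comp (hHc (ε / m)).measurable)
    simp only [inter_univ, preimage_univ, ← hvol, Function.comp_apply] at c1 c2
    simp only [e1, e2]
    have hKof : (K : ℝ≥0∞) = ENNReal.ofReal K := by simp
    constructor
    · calc _ ≤ ∫⁻ x in T.source, (K : ℝ≥0∞) * ENNReal.ofReal (H (ε / m) (T x)) := by
            refine setLIntegral_mono' T.open_source.measurableSet fun x hx => ?_
            rw [hKof, ← ENNReal.ofReal_mul K.coe_nonneg, hw x hx]
            refine ENNReal.ofReal_le_ofReal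
              (mul_le_mul_of_nonneg_right ?_ (hH0 _ (div_pos hε hm) _))
            exact (div_le_iff₀ hm).2 (hgrad x hx).1
        _ = K * ∫⁻ x in T.source, ENNReal.ofReal (H (ε / m) (T x)) :=
            lintegral_const_mul' _ _ (by simp)
        _ ≤ K * (K ^ 3 * _) := mul_le_mul_right c1 _
        _ = _ := by ring
    · calc _ ≤ _ := c2
        _ ≤ K ^ 3 * ∫⁻ x in T.source, (K : ℝ≥0∞) * ENNReal.ofReal (g x * weight ζ ε ψ x) := by
            refine mul_le_mul_right
              (setLIntegral_mono' T.open_source.measurableSet fun x hx => ?_) _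
            rw [hKof, ← ENNReal.ofReal_mul K.coe_nonneg, hw x hx, ← mul_assoc]
            refine ENNReal.ofReal_le_ofReal (le_mul_of_one_le_left (hH0 _ (div_pos hε hm) _) ?_)
            rw [mul_div_assoc', le_div_iff₀ hm, one_mul]
            exact (hgrad x hx).2
        _ = _ := by rw [lintegral_const_mul' _ _ (by simp)]; ring
  · rw [ofReal_integral_eq_lintegral_ofReal hLi (Eventually.of_forall hG0)]
    obtain ⟨c1, c2⟩ := setLIntegral_comp_comparable T hT hT' 2 (A := {x | ψ x = 0}) hAS
      (ENNReal.measurable_ofReal.comp hGc.measurable)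
    have e1 : ∫⁻ x in {x | ψ x = 0}, ENNReal.ofReal (g x) ∂(μHE[2] : Measure E3) =
        ∫⁻ x in T.source ∩ {x | ψ x = 0}, ENNReal.ofReal (G (T x)) ∂(μHE[2] : Measure E3) := by
      rw [lintegral_eq_setLIntegral_of_eq_zero T.open_source.measurableSet
        fun x hx => by simp [hgout x hx], Measure.restrict_restrict T.open_source.measurableSet]
      refine setLIntegral_congr_fun hAS fun x hx => ?_
      simp only [hGT x hx.1]
    have e2 : ∫⁻ y in {y | inner ℝ e (y - x₀) = 0}, ENNReal.ofReal (G y) ∂(μHE[2] : Measure E3) =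
        ∫⁻ y in T.target ∩ T.symm ⁻¹' {x | ψ x = 0},
          ENNReal.ofReal (G y) ∂(μHE[2] : Measure E3) := by
      rw [lintegral_eq_setLIntegral_of_eq_zero T.open_target.measurableSet
        fun x hx => by simp [hGout x hx],
        Measure.restrict_restrict T.open_target.measurableSet, hAT]
    rw [e1, e2]
    have hK24 : (K : ℝ≥0∞) ^ 2 ≤ K ^ 4 := pow_le_pow_right₀ hK1 (by norm_num)
    exact ⟨c1.trans (mul_le_mul_left hK24 _), c2.trans (mul_le_mul_left hK24 _)⟩

theorem continuous_mul_weight {Ω : Set E3} (hΩ : IsOpen Ω) {ψ : E3 → ℝ}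
    (hψ : ContDiffOn ℝ 1 ψ Ω) {ζ : ℝ → ℝ} (hζ : Continuous ζ) {g : E3 → ℝ} (hg : ContinuousOn g Ω)
    (hgΩ : tsupport g ⊆ Ω) (ε : ℝ) : Continuous (fun x => g x * weight ζ ε ψ x) := by
  refine ContinuousOn.continuous_of_tsupport_subset ?_ hΩ
    ((tsupport_mul_subset_left (f := g) (g := weight ζ ε ψ)).trans hgΩ)
  have hgrad : ContinuousOn (fun x => ‖∇ ψ x‖) Ω :=
    ((InnerProductSpace.toDual ℝ E3).symm.continuous.comp_continuousOn
      (hψ.continuousOn_fderiv_of_isOpen hΩ le_rfl)).norm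
  exact hg.mul (hgrad.mul (continuousOn_const.mul
    (hζ.comp_continuousOn (hψ.continuousOn.div_const ε))))

theorem tendsto_lintegral_weight {Ω : Set E3} (hΩ : IsOpen Ω) {ψ : E3 → ℝ}
    (hψ : ContDiffOn ℝ 1 ψ Ω) (hreg : ∀ x ∈ Ω, ∇ ψ x ≠ 0)
    {ζ : ℝ → ℝ} (hζ : Continuous ζ) (hζ0 : ∀ r, 0 ≤ ζ r)
    (hζsupp : Function.support ζ ⊆ Icc (-1) 1) (hζ1 : ∫ r, ζ r = 1)
    {g : E3 → ℝ} (hg : Continuous g) (hg0 : ∀ x, 0 ≤ g x) (hgc : HasCompactSupport g)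
    (hgΩ : tsupport g ⊆ Ω) :
    (∫⁻ x in {x | ψ x = 0}, ENNReal.ofReal (g x) ∂(μHE[2] : Measure E3)) ≠ ⊤ ∧
      Tendsto (fun ε => ∫⁻ x, ENNReal.ofReal (g x * weight ζ ε ψ x)) (𝓝[>] 0)
        (𝓝 (∫⁻ x in {x | ψ x = 0}, ENNReal.ofReal (g x) ∂(μHE[2] : Measure E3))) := by
  refine tendsto_of_asymptoticallyComparable 4 fun K hK => ?_
  choose! U hUo hxU hU using fun x (hx : x ∈ Ω) =>
    exists_isOpen_asymptoticallyComparable hΩ hψ hx (hreg x hx) hζ hζ0 hζsupp hζ1 hK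
  obtain ⟨t, ht⟩ := hgc.isCompact.elim_finite_subcover (fun x : Ω => U x) (fun x => hUo x x.2)
    fun x hx => mem_iUnion.2 ⟨⟨x, hgΩ hx⟩, hxU x (hgΩ hx)⟩
  obtain ⟨f, hfU, hf1, hf01, hfc⟩ := exists_continuous_sum_one_of_isOpen_isCompact
    (s := fun i : Fin t.card => U (t.equivFin.symm i : Ω)) (fun i => hUo _ (Subtype.prop _))
    hgc.isCompact (by
      intro x hx
      obtain ⟨y, hy, hxy⟩ := mem_iUnion₂.1 (ht hx)
      exact mem_iUnion.2 ⟨t.equivFin ⟨y, hy⟩, by simpa using hxy⟩)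
  have hsum : ∀ x, g x = ∑ i, f i x * g x := by
    intro x
    by_cases hx : x ∈ tsupport g
    · have := hf1 hx
      rw [← Finset.sum_mul]
      simp only [Finset.sum_apply, Pi.one_apply] at this
      rw [this, one_mul]
    · simp [image_eq_zero_of_notMem_tsupport hx]
  have hfg : ∀ i, Continuous (fun x => f i x * g x) := fun i => (f i).continuous.mul hg
  have hfgΩ : ∀ i, tsupport (fun x => f i x * g x) ⊆ Ω := fun i =>
    (tsupport_mul_subset_right (f := f i) (g := g)).trans hgΩ
  have key := AsymptoticallyComparable.sum Finset.univ fun i _ =>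
    hU _ (Subtype.prop (t.equivFin.symm i : Ω)) (fun x => f i x * g x) (hfg i)
      (fun x => mul_nonneg (hf01 i x).1 (hg0 x)) hgc.mul_left
      ((tsupport_mul_subset_left (f := f i) (g := g)).trans (hfU i))
  have hs : (∫⁻ x in {x | ψ x = 0}, ENNReal.ofReal (g x) ∂(μHE[2] : Measure E3)) =
      ∑ i, ∫⁻ x in {x | ψ x = 0}, ENNReal.ofReal (f i x * g x) ∂(μHE[2] : Measure E3) := by
    rw [← lintegral_finsetSum _ fun i _ => (hfg i).measurable.ennreal_ofReal]
    refine lintegral_congr fun x => ?_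
    rw [← ENNReal.ofReal_sum_of_nonneg fun i _ => mul_nonneg (hf01 i x).1 (hg0 x), ← hsum]
  obtain ⟨A, L, hL, hA, hV, h12⟩ := key
  rw [hs]
  refine ⟨A, L, hL, hA, ?_, h12⟩
  filter_upwards [hV, self_mem_nhdsWithin] with ε hε hε0
  have : ∫⁻ x, ENNReal.ofReal (g x * weight ζ ε ψ x) =
      ∑ i, ∫⁻ x, ENNReal.ofReal (f i x * g x * weight ζ ε ψ x) := by
    rw [← lintegral_finsetSum _ fun i _ => Measurable.ennreal_ofReal
      (continuous_mul_weight hΩ hψ hζ (hfg i).continuousOn (hfgΩ i) ε).measurable]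
    refine lintegral_congr fun x => ?_
    rw [← ENNReal.ofReal_sum_of_nonneg, ← Finset.sum_mul, ← hsum]
    intro i _
    exact mul_nonneg (mul_nonneg (hf01 i x).1 (hg0 x))
      (mul_nonneg (norm_nonneg _) (mul_nonneg (inv_nonneg.2 (le_of_lt hε0)) (hζ0 _)))
  rw [this]
  exact hε

/-- The static limit: the kernels `|∇ψ| ε⁻¹ ζ(ψ/ε)` converge to the area measure of `{ψ = 0}`. -/
theorem tendsto_integral_weight {Ω : Set E3} (hΩ : IsOpen Ω) {ψ : E3 → ℝ}
    (hψ : ContDiffOn ℝ 1 ψ Ω) (hreg : ∀ x ∈ Ω, ∇ ψ x ≠ 0)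
    {ζ : ℝ → ℝ} (hζ : Continuous ζ) (hζ0 : ∀ r, 0 ≤ ζ r)
    (hζsupp : Function.support ζ ⊆ Icc (-1) 1) (hζ1 : ∫ r, ζ r = 1)
    {g : E3 → ℝ} (hg : Continuous g) (hgc : HasCompactSupport g) (hgΩ : tsupport g ⊆ Ω) :
    SurfaceIntegrable ψ g ∧
      Tendsto (fun ε => ∫ x, g x * weight ζ ε ψ x) (𝓝[>] 0) (𝓝 (surfaceIntegral ψ g)) := by
  have pos : ∀ h : E3 → ℝ, Continuous h → (∀ x, 0 ≤ h x) → HasCompactSupport h →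
      tsupport h ⊆ Ω → SurfaceIntegrable ψ h ∧
      Tendsto (fun ε => ∫ x, h x * weight ζ ε ψ x) (𝓝[>] 0) (𝓝 (surfaceIntegral ψ h)) := by
    intro h hc h0 hcs hΩ'
    obtain ⟨h1, h2⟩ := tendsto_lintegral_weight hΩ hψ hreg hζ hζ0 hζsupp hζ1 hc h0 hcs hΩ'
    refine ⟨⟨hc.aestronglyMeasurable, ?_⟩, ?_⟩
    · rw [hasFiniteIntegral_iff_ofReal (Eventually.of_forall h0)]
      exact h1.lt_top
    · rw [surfaceIntegral, integral_eq_lintegral_of_nonneg_ae (Eventually.of_forall h0)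
        hc.aestronglyMeasurable]
      refine ((ENNReal.tendsto_toReal h1).comp h2).congr' ?_
      filter_upwards [self_mem_nhdsWithin] with ε hε
      refine (integral_eq_lintegral_of_nonneg_ae (Eventually.of_forall fun x => ?_)
        (continuous_mul_weight hΩ hψ hζ hc.continuousOn hΩ' ε).aestronglyMeasurable).symm
      exact mul_nonneg (h0 x)
        (mul_nonneg (norm_nonneg _) (mul_nonneg (inv_nonneg.2 (le_of_lt hε)) (hζ0 _)))
  have hsub : ∀ h : ℝ → ℝ, h 0 = 0 → tsupport (fun x => h (g x)) ⊆ tsupport g := fun h h0 =>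
    closure_mono (Function.support_comp_subset h0 g)
  have hp := pos (fun x => max (g x) 0) (by fun_prop) (fun x => le_max_right _ _)
    (hgc.comp_left (g := fun r : ℝ => max r 0) (by simp))
    ((hsub (fun r => max r 0) (by simp)).trans hgΩ)
  have hn := pos (fun x => max (-g x) 0) (by fun_prop) (fun x => le_max_right _ _)
    (hgc.comp_left (g := fun r : ℝ => max (-r) 0) (by simp))
    ((hsub (fun r => max (-r) 0) (by simp)).trans hgΩ)
  -- split `g` into its positive and negative parts
  have hgpn : ∀ x, g x = max (g x) 0 - max (-g x) 0 := fun x => by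
    rcases le_total (g x) 0 with h | h
    · rw [max_eq_right h, max_eq_left (by linarith)]; ring
    · rw [max_eq_left h, max_eq_right (by linarith)]; ring
  refine ⟨(hp.1.sub hn.1).congr (Eventually.of_forall fun x => (hgpn x).symm), ?_⟩
  have hlim := hp.2.sub hn.2
  have hs : surfaceIntegral ψ g =
      surfaceIntegral ψ (fun x => max (g x) 0) - surfaceIntegral ψ (fun x => max (-g x) 0) := by
    rw [surfaceIntegral, surfaceIntegral, surfaceIntegral, ← integral_sub hp.1 hn.1]
    exact integral_congr_ae (Eventually.of_forall hgpn)
  rw [hs]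
  refine hlim.congr fun ε => ?_
  have hi : ∀ h : ℝ → ℝ, Continuous h → h 0 = 0 →
      Integrable (fun x => h (g x) * weight ζ ε ψ x) := fun h hc h0 =>
    (continuous_mul_weight hΩ hψ hζ (hc.comp hg).continuousOn
      ((hsub h h0).trans hgΩ) ε).integrable_of_hasCompactSupport (hgc.comp_left h0).mul_right
  rw [← integral_sub (hi (fun r => max r 0) (by fun_prop) (by simp))
    (hi (fun r => max (-r) 0) (by fun_prop) (by simp))]
  refine integral_congr_ae (Eventually.of_forall fun x => ?_)
  simp only [← sub_mul, ← hgpn]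

end LevelSetLimit

/-! ### Divergence and integration by parts -/

theorem contDiff_of_forall_mem_tsupport {E F : Type*} [NormedAddCommGroup E] [NormedSpace ℝ E]
    [NormedAddCommGroup F] [NormedSpace ℝ F] {n : ℕ∞ω} {f : E → F}
    (h : ∀ x ∈ tsupport f, ContDiffAt ℝ n f x) : ContDiff ℝ n f := by
  refine contDiff_iff_contDiffAt.2 fun x => ?_
  by_cases hx : x ∈ tsupport f
  · exact h x hx
  · exact (contDiffAt_const (c := (0 : F))).congr_of_eventuallyEq
      (notMem_tsupport_iff_eventuallyEq.1 hx)

theorem divergence_congr {v w : E3 → E3} {x : E3} (h : v =ᶠ[𝓝 x] w) :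
    divergence v x = divergence w x := by
  simp only [divergence, h.fderiv_eq]

theorem sum_single_smul (v : E3) : ∑ i : Fin 3, v i • (EuclideanSpace.single i 1 : E3) = v := by
  simpa using (EuclideanSpace.basisFun (Fin 3) ℝ).sum_repr v

theorem divergence_smul {a : E3 → ℝ} {v : E3 → E3} {x : E3} (ha : DifferentiableAt ℝ a x)
    (hv : DifferentiableAt ℝ v x) :
    divergence (fun y => a y • v y) x = a x * divergence v x + fderiv ℝ a x (v x) := by
  have h : fderiv ℝ a x (v x) = ∑ i : Fin 3, v x i * fderiv ℝ a x (EuclideanSpace.single i 1) := by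
    conv_lhs => rw [← sum_single_smul (v x)]
    simp
  rw [h, divergence, divergence, Finset.mul_sum, ← Finset.sum_add_distrib]
  refine Finset.sum_congr rfl fun i _ => ?_
  rw [fderiv_fun_smul ha hv]
  simp [mul_comm]

theorem continuous_divergence {v : E3 → E3} (hv : ContDiff ℝ 1 v) : Continuous (divergence v) := by
  have := hv.continuous_fderiv one_ne_zero
  unfold divergence
  fun_prop

theorem support_divergence_subset (v : E3 → E3) : Function.support (divergence v) ⊆ tsupport v := by
  intro x hx
  by_contra h
  refine hx ?_
  have : v =ᶠ[𝓝 x] fun _ => 0 := notMem_tsupport_iff_eventuallyEq.1 h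
  rw [divergence_congr this]
  simp [LevelSetShape.divergence]

theorem hasCompactSupport_divergence {v : E3 → E3} (hv : HasCompactSupport v) :
    HasCompactSupport (divergence v) :=
  hv.mono' (support_divergence_subset v)

theorem integral_divergence_eq_zero {v : E3 → E3} (hv : ContDiff ℝ 1 v) (hc : HasCompactSupport v) :
    ∫ x, divergence v x = 0 := by
  have hcont : ∀ i, Continuous fun x => fderiv ℝ v x (EuclideanSpace.single i 1) i := by
    have := hv.continuous_fderiv one_ne_zero
    intro i
    fun_prop
  have hint : ∀ i, Integrable fun x => fderiv ℝ v x (EuclideanSpace.single i 1) i := fun i =>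
    (hcont i).integrable_of_hasCompactSupport
      ((hc.fderiv ℝ).comp_left (g := fun L : E3 →L[ℝ] E3 => L (EuclideanSpace.single i 1) i) rfl)
  unfold LevelSetShape.divergence
  rw [integral_finsetSum _ fun i _ => hint i]
  refine Finset.sum_eq_zero fun i _ => ?_
  have hvi : ContDiff ℝ 1 (fun x => v x i) := by fun_prop
  have hvint : Integrable (fun x => v x i) := hvi.continuous.integrable_of_hasCompactSupport
    (hc.comp_left (g := fun y : E3 => y i) rfl)
  have hd : ∀ x, fderiv ℝ (fun x => v x i) x (EuclideanSpace.single i 1) =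
      fderiv ℝ v x (EuclideanSpace.single i 1) i := fun x => by
    have := ((EuclideanSpace.proj i : E3 →L[ℝ] ℝ).hasFDerivAt.comp x
      (hv.differentiable one_ne_zero x).hasFDerivAt).fderiv
    exact congrArg (fun L : E3 →L[ℝ] ℝ => L (EuclideanSpace.single i 1)) this
  have h := integral_mul_fderiv_eq_neg_fderiv_mul_of_integrable 
    (μ := (volume : Measure E3))
    (f := fun _ : E3 => (1 : ℝ)) (g := fun x => v x i) (v := EuclideanSpace.single i 1)
    (by simp) (by simpa [hd] using hint i)
    (by simpa using hvint)
    (fun x _ => differentiableAt_const _) (fun x _ => hvi.differentiable one_ne_zero x)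
  simpa [hd] using h

/-- Integration by parts for `v · ∇(Z ∘ ψ)`; nothing is assumed on `ψ` away from the
support of `v`. -/
theorem integral_deriv_comp_mul_eq {U : Set E3} (hU : IsOpen U) {ψ : E3 → ℝ}
    (hψ : ContDiffOn ℝ 1 ψ U) {v : E3 → E3} (hv : ContDiffOn ℝ 1 v U) (hc : HasCompactSupport v)
    (hvU : tsupport v ⊆ U) {Z : ℝ → ℝ} (hZ : ContDiff ℝ 1 Z) :
    ∫ x, deriv Z (ψ x) * fderiv ℝ ψ x (v x) = -∫ x, divergence v x * Z (ψ x) := by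
  have hv1 : ContDiff ℝ 1 v :=
    contDiff_of_forall_mem_tsupport fun x hx => hv.contDiffAt (hU.mem_nhds (hvU hx))
  have hsupp : tsupport (fun x => Z (ψ x) • v x) ⊆ tsupport v := tsupport_smul_subset_right _ _
  have hψx : ∀ x ∈ tsupport v, ContDiffAt ℝ 1 ψ x := fun x hx =>
    hψ.contDiffAt (hU.mem_nhds (hvU hx))
  have hw : ContDiff ℝ 1 (fun x => Z (ψ x) • v x) := contDiff_of_forall_mem_tsupport fun x hx =>
    (hZ.contDiffAt.comp x (hψx x (hsupp hx))).smul hv1.contDiffAt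
  have h0 := integral_divergence_eq_zero hw (hc.mono' (subset_closure.trans hsupp))
  have hdiv : ∀ x, divergence (fun x => Z (ψ x) • v x) x =
      divergence v x * Z (ψ x) + deriv Z (ψ x) * fderiv ℝ ψ x (v x) := by
    intro x
    by_cases hx : x ∈ tsupport v
    · have hψd := (hψx x hx).differentiableAt one_ne_zero
      have hcomp : HasFDerivAt (fun x => Z (ψ x)) (deriv Z (ψ x) • fderiv ℝ ψ x) x :=
        (hZ.differentiable one_ne_zero (ψ x)).hasDerivAt.comp_hasFDerivAt x hψd.hasFDerivAt
      rw [divergence_smul hcomp.differentiableAt (hv1.differentiable one_ne_zero x), hcomp.fderiv]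
      simp [mul_comm]
    · have h1 : divergence (fun x => Z (ψ x) • v x) x = 0 := by
        by_contra h; exact hx (hsupp (support_divergence_subset _ h))
      have h2 : divergence v x = 0 := by
        by_contra h; exact hx (support_divergence_subset _ h)
      simp [h1, h2, image_eq_zero_of_notMem_tsupport hx]
  have hi1 : Integrable (fun x => divergence v x * Z (ψ x)) := by
    refine Continuous.integrable_of_hasCompactSupport ?_ (hasCompactSupport_divergence hc).mul_right
    refine ContinuousOn.continuous_of_tsupport_subset (s := U) ?_ hU ?_
    · exact (continuous_divergence hv1).continuousOn.mul
        (hZ.continuous.comp_continuousOn hψ.continuousOn)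
    · exact (tsupport_mul_subset_left).trans
        ((closure_minimal (support_divergence_subset v) (isClosed_tsupport v)).trans hvU)
  have hi2 : Integrable (fun x => deriv Z (ψ x) * fderiv ℝ ψ x (v x)) := by
    have : ∀ x, deriv Z (ψ x) * fderiv ℝ ψ x (v x) =
      divergence (fun x => Z (ψ x) • v x) x - divergence v x * Z (ψ x) := fun x => by
        rw [hdiv]; ring
    simp only [this]
    exact ((continuous_divergence hw).integrable_of_hasCompactSupport
      (hasCompactSupport_divergence (hc.mono' (subset_closure.trans hsupp)))).sub hi1
  simp only [hdiv] at h0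
  rw [integral_add hi1 hi2] at h0
  linarith

/-! ### Smooth functions of time and space -/

/-- `h` is a smooth function of time and space on the set `N`. -/
abbrev SmoothOnSpacetime {F : Type*} [NormedAddCommGroup F] [NormedSpace ℝ F] (N : Set (ℝ × E3))
    (h : ℝ → E3 → F) : Prop :=
  ContDiffOn ℝ ∞ (fun p : ℝ × E3 => h p.1 p.2) N

namespace SmoothOnSpacetime

variable {F : Type*} [NormedAddCommGroup F] [NormedSpace ℝ F] {N : Set (ℝ × E3)}
  {h : ℝ → E3 → F} {s : ℝ} {x : E3}

theorem contDiffAt (hh : SmoothOnSpacetime N h) (hN : IsOpen N) (hp : (s, x) ∈ N) :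
    ContDiffAt ℝ ∞ (fun p : ℝ × E3 => h p.1 p.2) (s, x) :=
  ContDiffOn.contDiffAt hh (hN.mem_nhds hp)

theorem hasFDerivAt (hh : SmoothOnSpacetime N h) (hN : IsOpen N) (hp : (s, x) ∈ N) :
    HasFDerivAt (h s) ((fderiv ℝ (fun p : ℝ × E3 => h p.1 p.2) (s, x)).comp
      (ContinuousLinearMap.inr ℝ ℝ E3)) x := by
  have h1 := ((hh.contDiffAt hN hp).differentiableAt (by simp)).hasFDerivAt
  exact h1.comp x (hasFDerivAt_prodMk_right s x)

theorem hasDerivAt (hh : SmoothOnSpacetime N h) (hN : IsOpen N) (hp : (s, x) ∈ N) :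
    HasDerivAt (fun r => h r x) (fderiv ℝ (fun p : ℝ × E3 => h p.1 p.2) (s, x) (1, 0)) s := by
  have h1 := ((hh.contDiffAt hN hp).differentiableAt (by simp)).hasFDerivAt
  have h2 := (h1.comp s (hasFDerivAt_prodMk_left s x)).hasDerivAt
  exact h2.congr_deriv (by simp)

theorem space_contDiffAt (hh : SmoothOnSpacetime N h) (hN : IsOpen N) (hp : (s, x) ∈ N) :
    ContDiffAt ℝ ∞ (h s) x :=
  (hh.contDiffAt hN hp).comp x (contDiffAt_const.prodMk contDiffAt_id)

theorem fderiv (hh : SmoothOnSpacetime N h) (hN : IsOpen N) :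
    SmoothOnSpacetime N (fun s x => fderiv ℝ (h s) x) := by
  refine ContDiffOn.congr
    (f := fun p : ℝ × E3 => (_root_.fderiv ℝ (fun p : ℝ × E3 => h p.1 p.2) p).comp
      (ContinuousLinearMap.inr ℝ ℝ E3)) ?_ fun p hp => (hh.hasFDerivAt hN hp).fderiv
  exact (hh.fderiv_of_isOpen hN le_rfl).clm_comp contDiffOn_const

theorem deriv (hh : SmoothOnSpacetime N h) (hN : IsOpen N) :
    SmoothOnSpacetime N (fun s x => deriv (fun r => h r x) s) := by
  refine ContDiffOn.congr
    (f := fun p : ℝ × E3 => _root_.fderiv ℝ (fun p : ℝ × E3 => h p.1 p.2) p (1, 0))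
    ?_ fun p hp => (hh.hasDerivAt hN hp).deriv
  exact (hh.fderiv_of_isOpen hN le_rfl).clm_apply contDiffOn_const

theorem iteratedFDeriv (hh : SmoothOnSpacetime N h) (hN : IsOpen N) (n : ℕ) :
    SmoothOnSpacetime N (fun s x => iteratedFDeriv ℝ n (h s) x) := by
  induction n with
  | zero =>
    simp only [SmoothOnSpacetime, iteratedFDeriv_zero_eq_comp, Function.comp_apply]
    exact (ContinuousLinearEquiv.contDiff
      (continuousMultilinearCurryFin0 ℝ E3 F).symm.toContinuousLinearEquiv).comp_contDiffOn hh
  | succ n ih =>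
    simp only [SmoothOnSpacetime, iteratedFDeriv_succ_eq_comp_left, Function.comp_apply]
    exact (LinearIsometryEquiv.contDiff _).comp_contDiffOn (ih.fderiv hN)

theorem gradient {h : ℝ → E3 → ℝ} (hh : SmoothOnSpacetime N h) (hN : IsOpen N) :
    SmoothOnSpacetime N (fun s x => ∇ (h s) x) :=
  (LinearIsometryEquiv.contDiff (InnerProductSpace.toDual ℝ E3).symm).comp_contDiffOn (hh.fderiv hN)

theorem divergence {h : ℝ → E3 → E3} (hh : SmoothOnSpacetime N h) (hN : IsOpen N) :
    SmoothOnSpacetime N (fun s x => divergence (h s) x) := by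
  unfold LevelSetShape.divergence
  refine ContDiffOn.sum fun i _ => ?_
  exact (EuclideanSpace.proj i : E3 →L[ℝ] ℝ).contDiff.comp_contDiffOn
    ((hh.fderiv hN).clm_apply contDiffOn_const)

theorem normal {h : ℝ → E3 → ℝ} (hh : SmoothOnSpacetime N h) (hN : IsOpen N)
    (hreg : ∀ p ∈ N, ∇ (h p.1) p.2 ≠ 0) : SmoothOnSpacetime N (fun s x => normal (h s) x) :=
  (((hh.gradient hN).norm ℝ hreg).inv fun p hp => norm_ne_zero_iff.2 (hreg p hp)).smul
    (hh.gradient hN)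

theorem density {k : ℕ} {f : Jet k → ℝ} (hf : ContDiffOn ℝ ∞ f (regularJets k))
    {h : ℝ → E3 → ℝ} (hh : SmoothOnSpacetime N h) (hN : IsOpen N)
    (hreg : ∀ p ∈ N, ∇ (h p.1) p.2 ≠ 0) : SmoothOnSpacetime N (fun s x => density f (h s) x) := by
  refine hf.comp (contDiffOn_pi.2 fun i => hh.iteratedFDeriv hN i) fun p hp => ?_
  intro h0
  refine hreg p hp ?_
  have h1 : ‖_root_.iteratedFDeriv ℝ 1 (h p.1) p.2‖ = 0 := norm_eq_zero.2 h0
  rw [norm_iteratedFDeriv_one, norm_eq_zero] at h1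
  simp [_root_.gradient, h1]

/-- The time derivative commutes with the divergence, by symmetry of the second derivative in
time and space. -/
theorem hasDerivAt_divergence {h : ℝ → E3 → E3} (hh : SmoothOnSpacetime N h) (hN : IsOpen N)
    (hp : (s, x) ∈ N) :
    HasDerivAt (fun r => LevelSetShape.divergence (h r) x)
      (LevelSetShape.divergence (fun y => _root_.deriv (fun r => h r y) s) x) s := by
  set H : ℝ × E3 → E3 := fun p => h p.1 p.2 with hH
  have hHc : ContDiffAt ℝ ∞ H (s, x) := hh.contDiffAt hN hp
  have h2 : HasFDerivAt (_root_.fderiv ℝ H) (_root_.fderiv ℝ (_root_.fderiv ℝ H) (s, x)) (s, x) :=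
    ((hHc.fderiv_right (m := 1) (by norm_cast)).differentiableAt one_ne_zero).hasFDerivAt
  have hsymm : IsSymmSndFDerivAt ℝ H (s, x) :=
    hHc.isSymmSndFDerivAt (by rw [minSmoothness_of_isRCLikeNormedField]; norm_cast)
  have hNt : ∀ᶠ r in 𝓝 s, (r, x) ∈ N :=
    (Continuous.prodMk_left x).continuousAt.eventually (hN.mem_nhds hp)
  have hNx : ∀ᶠ y in 𝓝 x, (s, y) ∈ N :=
    (Continuous.prodMk_right s).continuousAt.eventually (hN.mem_nhds hp)
  have e1 : (fun r => LevelSetShape.divergence (h r) x) =ᶠ[𝓝 s]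
      fun r => ∑ i : Fin 3, _root_.fderiv ℝ H (r, x) (0, EuclideanSpace.single i 1) i := by
    filter_upwards [hNt] with r hr
    unfold LevelSetShape.divergence
    rw [(hh.hasFDerivAt hN hr).fderiv]
    simp [hH]
  have e2 : (fun y => _root_.deriv (fun r => h r y) s) =ᶠ[𝓝 x]
      fun y => _root_.fderiv ℝ H (s, y) (1, 0) := by
    filter_upwards [hNx] with y hy using (hh.hasDerivAt hN hy).deriv
  rw [divergence_congr e2]
  refine HasDerivAt.congr_of_eventuallyEq ?_ e1
  have e3 : HasFDerivAt (fun y => _root_.fderiv ℝ H (s, y) (1, 0))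
      (((ContinuousLinearMap.apply ℝ E3 ((1, 0) : ℝ × E3)).comp
        (_root_.fderiv ℝ (_root_.fderiv ℝ H) (s, x))).comp (ContinuousLinearMap.inr ℝ ℝ E3)) x :=
    (((ContinuousLinearMap.apply ℝ E3 ((1, 0) : ℝ × E3)).hasFDerivAt).comp (s, x) h2).comp x
      (hasFDerivAt_prodMk_right s x)
  unfold LevelSetShape.divergence
  rw [e3.fderiv]
  refine HasDerivAt.fun_sum fun i _ => ?_
  have h4 := HasFDerivAt.comp (f := fun r : ℝ => (r, x)) s h2 (hasFDerivAt_prodMk_left (𝕜 := ℝ) s x)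
  have h5 := ((((EuclideanSpace.proj i : E3 →L[ℝ] ℝ).comp (ContinuousLinearMap.apply ℝ E3
    ((0, EuclideanSpace.single i 1) : ℝ × E3))).hasFDerivAt).comp s h4).hasDerivAt
  refine h5.congr_deriv ?_
  have := congrArg (fun z : E3 => z i) (hsymm (1, 0) (0, EuclideanSpace.single i 1))
  simpa using this

end SmoothOnSpacetime

/-! ### Integrals depending on time -/

theorem integrable_of_continuousOn_isCompact {C : Set E3} (hC : IsCompact C) {g : E3 → ℝ}
    (hg : ContinuousOn g C) (hg0 : ∀ x ∉ C, g x = 0) : Integrable g :=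
  (integrableOn_iff_integrable_of_support_subset
    fun x hx => by_contra fun h => hx (hg0 x h)).1 (hg.integrableOn_compact hC)

theorem exists_forall_norm_le_of_continuousOn {N : Set (ℝ × E3)} {W : Set ℝ} (hW : IsOpen W)
    {C : Set E3} (hC : IsCompact C) (hWC : ∀ s ∈ W, ∀ x ∈ C, (s, x) ∈ N) {G : ℝ → E3 → ℝ}
    (hG : ContinuousOn (fun p : ℝ × E3 => G p.1 p.2) N) {s : ℝ} (hs : s ∈ W) :
    ∃ r > 0, Metric.ball s r ⊆ W ∧ ∃ M, ∀ s' ∈ Metric.ball s r, ∀ x ∈ C, ‖G s' x‖ ≤ M := by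
  obtain ⟨r, hr, hrW⟩ := Metric.nhds_basis_closedBall.mem_iff.1 (hW.mem_nhds hs)
  obtain ⟨M, hM⟩ := ((isCompact_closedBall s r).prod hC).exists_bound_of_continuousOn
    (hG.mono fun p hp => hWC p.1 (hrW hp.1) p.2 hp.2)
  exact ⟨r, hr, Metric.ball_subset_closedBall.trans hrW, M, fun s' hs' x hx =>
    hM (s', x) ⟨Metric.ball_subset_closedBall hs', hx⟩⟩

theorem hasDerivAt_integral_of_isCompact {N : Set (ℝ × E3)} {W : Set ℝ} (hW : IsOpen W)
    {C : Set E3} (hC : IsCompact C) (hWC : ∀ s ∈ W, ∀ x ∈ C, (s, x) ∈ N) {G G' : ℝ → E3 → ℝ}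
    (hG : ContinuousOn (fun p : ℝ × E3 => G p.1 p.2) N)
    (hG' : ContinuousOn (fun p : ℝ × E3 => G' p.1 p.2) N)
    (hG0 : ∀ s, ∀ x ∉ C, G s x = 0) (hG'0 : ∀ s, ∀ x ∉ C, G' s x = 0)
    (hd : ∀ s x, (s, x) ∈ N → HasDerivAt (fun r => G r x) (G' s x) s) {s : ℝ} (hs : s ∈ W) :
    HasDerivAt (fun r => ∫ x, G r x) (∫ x, G' s x) s := by
  obtain ⟨r, hr, hrW, M, hM⟩ := exists_forall_norm_le_of_continuousOn hW hC hWC hG' hs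
  have hint : ∀ {H : ℝ → E3 → ℝ}, ContinuousOn (fun p : ℝ × E3 => H p.1 p.2) N →
      (∀ s, ∀ x ∉ C, H s x = 0) → ∀ s' ∈ W, Integrable (H s') := fun hH hH0 s' hs' =>
    integrable_of_continuousOn_isCompact hC
      (hH.comp (f := fun x => (s', x)) (by fun_prop) fun x hx => hWC s' hs' x hx) (hH0 s')
  refine (hasDerivAt_integral_of_dominated_loc_of_deriv_le (bound := C.indicator fun _ => M)
    (Metric.ball_mem_nhds s hr) ?_ (hint hG hG0 s hs) (hint hG' hG'0 s hs).aestronglyMeasurable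
    (Eventually.of_forall fun x s' hs' => ?_) ?_ (Eventually.of_forall fun x s' hs' => ?_)).2
  · filter_upwards [hW.mem_nhds hs] with s' hs' using (hint hG hG0 s' hs').aestronglyMeasurable
  · by_cases hx : x ∈ C
    · rw [indicator_of_mem hx]; exact hM s' hs' x hx
    · rw [hG'0 s' x hx, indicator_of_notMem hx, norm_zero]
  · rw [integrable_indicator_iff hC.measurableSet]
    exact integrableOn_const hC.measure_lt_top.ne
  · by_cases hx : x ∈ C
    · exact hd s' x (hWC s' (hrW hs') x hx)
    · simp only [hG0 _ x hx, hG'0 _ x hx]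
      exact hasDerivAt_const _ _

/-- A bounded primitive of the kernel. -/
theorem exists_primitive {ζ : ℝ → ℝ} (hζ : Continuous ζ) (hζ0 : ∀ r, 0 ≤ ζ r)
    (hζ1 : ∫ r, ζ r = 1) :
    ∃ Z : ℝ → ℝ, ContDiff ℝ 1 Z ∧ (∀ r, HasDerivAt Z (ζ r) r) ∧ ∀ r, |Z r| ≤ 1 := by
  have hd : ∀ r, HasDerivAt (fun r => ∫ x in (0 : ℝ)..r, ζ x) (ζ r) r := fun r =>
    hζ.integral_hasStrictDerivAt 0 r |>.hasDerivAt
  refine ⟨fun r => ∫ x in (0 : ℝ)..r, ζ x, ?_, hd, fun r => ?_⟩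
  · rw [contDiff_one_iff_deriv]
    refine ⟨fun r => (hd r).differentiableAt, ?_⟩
    rwa [show deriv (fun r => ∫ x in (0 : ℝ)..r, ζ x) = ζ from funext fun r => (hd r).deriv]
  · have hi : Integrable ζ := integrable_of_integral_eq_one hζ1
    rw [← Real.norm_eq_abs]
    calc ‖∫ x in (0 : ℝ)..r, ζ x‖ ≤ ∫ x in uIoc 0 r, ‖ζ x‖ :=
          intervalIntegral.norm_integral_le_integral_norm_uIoc
      _ ≤ ∫ x, ‖ζ x‖ :=
          setIntegral_le_integral hi.norm (Eventually.of_forall fun _ => norm_nonneg _)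
      _ = 1 := by
          rw [← hζ1]
          exact integral_congr_ae (Eventually.of_forall fun x => Real.norm_of_nonneg (hζ0 x))

/-! ### Time derivative of the regularized integrals -/

/-- On the open set `N` of space-time, `φ` and `u` are smooth, `∇φ ≠ 0` and `φ_t + u · ∇φ = 0`. -/
structure IsRegularTransport (N : Set (ℝ × E3)) (φ : ℝ → E3 → ℝ) (u : ℝ → E3 → E3) : Prop where
  isOpen : IsOpen N
  smooth : SmoothOnSpacetime N φ
  smooth_velocity : SmoothOnSpacetime N u
  gradient_ne_zero : ∀ p ∈ N, ∇ (φ p.1) p.2 ≠ 0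
  transport : ∀ s x, (s, x) ∈ N → deriv (fun r => φ r x) s + inner ℝ (u s x) (∇ (φ s) x) = 0

/-- `χ` is a smooth compactly supported function on space whose support lies, for each time in the
open set `W`, in the corresponding slice of `N`. -/
structure IsCutoff (N : Set (ℝ × E3)) (W : Set ℝ) (χ : E3 → ℝ) : Prop where
  isOpen : IsOpen W
  smooth : ContDiff ℝ ∞ χ
  hasCompactSupport : HasCompactSupport χ
  prod_subset : ∀ s ∈ W, ∀ x ∈ tsupport χ, (s, x) ∈ N

/-- The operator `D a = a_t + div(a n) u · n`, giving the rate of change of the surface integral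
of `a`. -/
noncomputable def shapeRate (φ : ℝ → E3 → ℝ) (u : ℝ → E3 → E3) (a : ℝ → E3 → ℝ)
    (s : ℝ) (x : E3) : ℝ :=
  deriv (fun r => a r x) s +
    divergence (fun y => a s y • normal (φ s) y) x * inner ℝ (u s x) (normal (φ s) x)

/-- The vector field `χ a n`. -/
noncomputable def cutoffField (χ : E3 → ℝ) (φ : ℝ → E3 → ℝ) (a : ℝ → E3 → ℝ) (s : ℝ)
    (x : E3) : E3 :=
  (χ x * a s x) • normal (φ s) x

section

variable {N : Set (ℝ × E3)} {φ : ℝ → E3 → ℝ} {u : ℝ → E3 → E3} {W : Set ℝ} {χ : E3 → ℝ}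
  {a : ℝ → E3 → ℝ} {ζ Z : ℝ → ℝ} {s ε : ℝ}

theorem tsupport_cutoffField_subset : tsupport (cutoffField χ φ a s) ⊆ tsupport χ :=
  (tsupport_smul_subset_left (fun x => χ x * a s x) (normal (φ s))).trans
    (tsupport_mul_subset_left (f := χ) (g := a s))

theorem smooth_cutoffField (h : IsRegularTransport N φ u) (hχ : IsCutoff N W χ)
    (ha : SmoothOnSpacetime N a) : SmoothOnSpacetime N (cutoffField χ φ a) :=
  (((hχ.smooth.comp contDiff_snd).contDiffOn).mul ha).smul
    (h.smooth.normal h.isOpen h.gradient_ne_zero)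

theorem smooth_shapeRate (h : IsRegularTransport N φ u) (ha : SmoothOnSpacetime N a) :
    SmoothOnSpacetime N (shapeRate φ u a) := by
  have hn := h.smooth.normal h.isOpen h.gradient_ne_zero
  have hd : SmoothOnSpacetime N (fun s x => divergence (fun y => a s y • normal (φ s) y) x) :=
    SmoothOnSpacetime.divergence (h := fun s y => a s y • normal (φ s) y) (ha.smul hn) h.isOpen
  exact (ha.deriv h.isOpen).add (hd.mul (h.smooth_velocity.inner ℝ hn))

theorem norm_normal {ψ : E3 → ℝ} {x : E3} (h : ∇ ψ x ≠ 0) : ‖normal ψ x‖ = 1 := by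
  rw [normal, norm_smul, norm_inv, norm_norm, inv_mul_cancel₀ (norm_ne_zero_iff.2 h)]

theorem norm_smul_normal {ψ : E3 → ℝ} {x : E3} (h : ∇ ψ x ≠ 0) : ‖∇ ψ x‖ • normal ψ x = ∇ ψ x := by
  rw [normal, smul_smul, mul_inv_cancel₀ (norm_ne_zero_iff.2 h), one_smul]

theorem fderiv_eq_norm_mul_inner {ψ : E3 → ℝ} {x : E3} (h : ∇ ψ x ≠ 0) (v : E3) :
    fderiv ℝ ψ x v = ‖∇ ψ x‖ * inner ℝ (normal ψ x) v := by
  rw [← inner_gradient_left, ← norm_smul_normal h, real_inner_smul_left, norm_smul_normal h]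

theorem fderiv_normal_self {ψ : E3 → ℝ} {x : E3} (h : ∇ ψ x ≠ 0) :
    fderiv ℝ ψ x (normal ψ x) = ‖∇ ψ x‖ := by
  rw [fderiv_eq_norm_mul_inner h, real_inner_self_eq_norm_sq, norm_normal h]; simp

/-- `∫ ε⁻¹ ζ(φ/ε) v · ∇φ = -∫ div v Z(φ/ε)` for a field `v` with compact support. -/
theorem integral_kernel_mul_fderiv_eq (h : IsRegularTransport N φ u) (hZ : ContDiff ℝ 1 Z)
    (hZ' : ∀ r, HasDerivAt Z (ζ r) r) {v : E3 → E3} (hvN : ∀ x ∈ tsupport v, (s, x) ∈ N)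
    (hv : ∀ x, (s, x) ∈ N → ContDiffAt ℝ 1 v x) (hc : HasCompactSupport v) (ε : ℝ) :
    ∫ x, (ε⁻¹ * ζ (φ s x / ε)) * fderiv ℝ (φ s) x (v x) =
      -∫ x, divergence v x * Z (φ s x / ε) := by
  have hU : IsOpen {x | (s, x) ∈ N} := h.isOpen.preimage (Continuous.prodMk_right s)
  have hd : ∀ r, deriv (fun r => Z (r / ε)) r = ε⁻¹ * ζ (r / ε) := fun r => by
    have := (hZ' (r / ε)).comp r ((hasDerivAt_id r).div_const ε)
    rw [show (fun r => Z (r / ε)) = Z ∘ fun r => id r / ε from rfl, this.deriv]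
    simp [div_eq_mul_inv, mul_comm]
  have := integral_deriv_comp_mul_eq hU (ψ := φ s) (v := v) (Z := fun r => Z (r / ε))
    (fun x hx => ((h.smooth.space_contDiffAt h.isOpen hx).of_le (by norm_cast)).contDiffWithinAt)
    (fun x hx => (hv x hx).contDiffWithinAt) hc hvN (by fun_prop)
  simpa only [hd] using this

theorem integral_cutoff_mul_weight_eq (h : IsRegularTransport N φ u) (hχ : IsCutoff N W χ)
    (ha : SmoothOnSpacetime N a) (hZ : ContDiff ℝ 1 Z) (hZ' : ∀ r, HasDerivAt Z (ζ r) r)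
    (hs : s ∈ W) (ε : ℝ) :
    ∫ x, χ x * a s x * weight ζ ε (φ s) x =
      -∫ x, divergence (cutoffField χ φ a s) x * Z (φ s x / ε) := by
  rw [← integral_kernel_mul_fderiv_eq h hZ hZ'
    (fun x hx => hχ.prod_subset s hs x (tsupport_cutoffField_subset hx))
    (fun x hx => ((smooth_cutoffField h hχ ha).space_contDiffAt h.isOpen hx).of_le (by norm_cast))
    (hχ.hasCompactSupport.mono' (subset_closure.trans tsupport_cutoffField_subset))]
  refine integral_congr_ae (Eventually.of_forall fun x => ?_)
  by_cases hx : x ∈ tsupport χ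
  · have := fderiv_normal_self (h.gradient_ne_zero _ (hχ.prod_subset s hs x hx))
    simp only [cutoffField, map_smul, this, weight, smul_eq_mul]
    ring
  · simp [cutoffField, image_eq_zero_of_notMem_tsupport hx]

theorem divergence_cutoffField_eq_zero {x : E3} (hx : x ∉ tsupport χ) :
    divergence (cutoffField χ φ a s) x = 0 := by
  by_contra h
  exact hx (tsupport_cutoffField_subset (support_divergence_subset _ h))

/-- The regularized integrals are bounded uniformly in `ε`, and locally uniformly in time: after
integration by parts the kernel appears only through its bounded primitive. -/
theorem exists_bound_integral_cutoff_mul_weight (h : IsRegularTransport N φ u)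
    (hχ : IsCutoff N W χ) (ha : SmoothOnSpacetime N a) (hζ : Continuous ζ) (hζ0 : ∀ r, 0 ≤ ζ r)
    (hζ1 : ∫ r, ζ r = 1) (hs : s ∈ W) :
    ∃ r > 0, Metric.ball s r ⊆ W ∧ ∃ M, ∀ s' ∈ Metric.ball s r, ∀ ε,
      |∫ x, χ x * a s' x * weight ζ ε (φ s') x| ≤ M := by
  obtain ⟨Z, hZ, hZ', hZ1⟩ := exists_primitive hζ hζ0 hζ1
  obtain ⟨r, hr, hrW, M, hM⟩ := exists_forall_norm_le_of_continuousOn hχ.isOpen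
    hχ.hasCompactSupport.isCompact hχ.prod_subset
    (G := fun s x => divergence (cutoffField χ φ a s) x)
    ((smooth_cutoffField h hχ ha).divergence h.isOpen).continuousOn hs
  refine ⟨r, hr, hrW, M * volume.real (tsupport χ), fun s' hs' ε => ?_⟩
  rw [integral_cutoff_mul_weight_eq h hχ ha hZ hZ' (hrW hs'), abs_neg,
    ← setIntegral_eq_integral_of_forall_compl_eq_zero (s := tsupport χ)
      fun x hx => by rw [divergence_cutoffField_eq_zero hx, zero_mul],
    ← Real.norm_eq_abs]
  refine norm_setIntegral_le_of_norm_le_const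
    (hχ.hasCompactSupport.isCompact.measure_lt_top (μ := volume)) fun x hx => ?_
  rw [norm_mul]
  calc _ ≤ M * 1 := mul_le_mul (hM s' hs' x hx) (hZ1 _) (abs_nonneg _)
        ((norm_nonneg _).trans (hM s' hs' x hx))
    _ = M := mul_one M

/-- The exact time derivative of the regularized integral of `χ a` is the regularized integral of
`χ D a`, provided that `χ = 1` near the support of the kernel. -/
theorem hasDerivAt_integral_cutoff_mul_weight (h : IsRegularTransport N φ u)
    (hχ : IsCutoff N W χ) (ha : SmoothOnSpacetime N a) (hζ : Continuous ζ) (hζ0 : ∀ r, 0 ≤ ζ r)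
    (hζ1 : ∫ r, ζ r = 1) (hζsupp : Function.support ζ ⊆ Icc (-1) 1) (hε : 0 < ε)
    (hχ1 : ∀ s ∈ W, ∀ x ∈ tsupport χ, |φ s x| ≤ ε → χ =ᶠ[𝓝 x] 1) (hs : s ∈ W) :
    HasDerivAt (fun r => ∫ x, χ x * a r x * weight ζ ε (φ r) x)
      (∫ x, χ x * shapeRate φ u a s x * weight ζ ε (φ s) x) s := by
  obtain ⟨Z, hZ, hZ', -⟩ := exists_primitive hζ hζ0 hζ1
  have hV := smooth_cutoffField h hχ ha
  set V := cutoffField χ φ a with hVdef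
  let Vt : ℝ → E3 → E3 := fun s x => deriv (fun r => V r x) s
  have hVt : SmoothOnSpacetime N Vt := hV.deriv h.isOpen
  have hVzero : ∀ s, ∀ x ∉ tsupport χ, V s x = 0 := fun s x hx => by
    simp [hVdef, cutoffField, image_eq_zero_of_notMem_tsupport hx]
  have hVtsupp : ∀ s, tsupport (Vt s) ⊆ tsupport χ := fun s =>
    closure_minimal (fun x hx => by_contra fun hxχ => hx (by simp [Vt, hVzero _ x hxχ]))
      (isClosed_tsupport χ)
  have hdVt : ∀ s, ∀ x ∉ tsupport χ, divergence (Vt s) x = 0 := fun s x hx => by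
    by_contra h; exact hx (hVtsupp s (support_divergence_subset _ h))
  have hdV : ∀ s, ∀ x ∉ tsupport χ, divergence (V s) x = 0 := fun s x hx =>
    divergence_cutoffField_eq_zero hx
  have hφt := h.smooth.deriv h.isOpen
  let G : ℝ → E3 → ℝ := fun s x => divergence (V s) x * Z (φ s x / ε)
  let G' : ℝ → E3 → ℝ := fun s x => divergence (Vt s) x * Z (φ s x / ε) +
    divergence (V s) x * (ζ (φ s x / ε) * (deriv (fun r => φ r x) s / ε))
  have hφc : ContinuousOn (fun p : ℝ × E3 => φ p.1 p.2 / ε) N := h.smooth.continuousOn.div_const ε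
  have hmain : HasDerivAt (fun r => ∫ x, G r x) (∫ x, G' s x) s := by
    refine hasDerivAt_integral_of_isCompact hχ.isOpen hχ.hasCompactSupport.isCompact hχ.prod_subset
      ?_ ?_ ?_ ?_ ?_ hs
    · exact (hV.divergence h.isOpen).continuousOn.mul (hZ.continuous.comp_continuousOn hφc)
    · exact ((hVt.divergence h.isOpen).continuousOn.mul (hZ.continuous.comp_continuousOn hφc)).add
        ((hV.divergence h.isOpen).continuousOn.mul ((hζ.comp_continuousOn hφc).mul
          (hφt.continuousOn.div_const ε)))
    · intro s x hx; simp [G, hdV s x hx]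
    · intro s x hx; simp [G', hdV s x hx, hdVt s x hx]
    · intro s x hp
      have h1 := hV.hasDerivAt_divergence h.isOpen hp
      have h2 := (h.smooth.hasDerivAt h.isOpen hp).differentiableAt.hasDerivAt
      exact h1.mul ((hZ' (φ s x / ε)).comp s (h2.div_const ε))
  have hJ : (fun r => ∫ x, χ x * a r x * weight ζ ε (φ r) x) =ᶠ[𝓝 s] fun r => -∫ x, G r x := by
    filter_upwards [hχ.isOpen.mem_nhds hs] with r hr
    exact integral_cutoff_mul_weight_eq h hχ ha hZ hZ' hr ε
  refine (hmain.neg.congr_of_eventuallyEq hJ).congr_deriv ?_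
  have hcont : ∀ {F : Type} [NormedAddCommGroup F] {g : ℝ → E3 → F},
      ContinuousOn (fun p : ℝ × E3 => g p.1 p.2) N → ContinuousOn (g s) (tsupport χ) := fun hg =>
    hg.comp (f := fun x => (s, x)) (by fun_prop) fun x hx => hχ.prod_subset s hs x hx
  have hi1 : Integrable (fun x => divergence (Vt s) x * Z (φ s x / ε)) :=
    integrable_of_continuousOn_isCompact hχ.hasCompactSupport.isCompact
      ((hcont (g := fun s x => divergence (Vt s) x) (hVt.divergence h.isOpen).continuousOn).mul
        (hZ.continuous.comp_continuousOn (hcont (g := fun s x => φ s x / ε) hφc)))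
      fun x hx => by rw [hdVt s x hx, zero_mul]
  have hi2 : Integrable (fun x => divergence (V s) x *
      (ζ (φ s x / ε) * (deriv (fun r => φ r x) s / ε))) :=
    integrable_of_continuousOn_isCompact hχ.hasCompactSupport.isCompact
      ((hcont (g := fun s x => divergence (V s) x) (hV.divergence h.isOpen).continuousOn).mul
        ((hζ.comp_continuousOn (hcont (g := fun s x => φ s x / ε) hφc)).mul
          ((hcont (g := fun s x => deriv (fun r => φ r x) s) hφt.continuousOn).div_const ε)))
      fun x hx => by rw [hdV s x hx, zero_mul]
  have hibp := integral_kernel_mul_fderiv_eq h hZ hZ'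
    (fun x hx => hχ.prod_subset s hs x (hVtsupp s hx))
    (fun x hx => (hVt.space_contDiffAt h.isOpen hx).of_le (by norm_cast))
    (hχ.hasCompactSupport.mono' (subset_closure.trans (hVtsupp s))) ε
  have hi3 : Integrable (fun x => (ε⁻¹ * ζ (φ s x / ε)) * fderiv ℝ (φ s) x (Vt s x)) :=
    integrable_of_continuousOn_isCompact hχ.hasCompactSupport.isCompact
      ((continuousOn_const.mul (hζ.comp_continuousOn (hcont (g := fun s x => φ s x / ε) hφc))).mul
        ((hcont (g := fun s x => fderiv ℝ (φ s) x) (h.smooth.fderiv h.isOpen).continuousOn).clm_apply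
          (hcont hVt.continuousOn)))
      fun x hx => by
        rw [image_eq_zero_of_notMem_tsupport fun hx' => hx (hVtsupp s hx'), map_zero, mul_zero]
  rw [integral_add hi1 hi2, neg_add, ← hibp, ← sub_eq_add_neg, ← integral_sub hi3 hi2]
  refine integral_congr_ae (Eventually.of_forall fun x => ?_)
  by_cases hx : x ∈ tsupport χ
  swap
  · simp [hdV s x hx, image_eq_zero_of_notMem_tsupport hx,
      image_eq_zero_of_notMem_tsupport fun hx' => hx (hVtsupp s hx')]
  by_cases hζx : ζ (φ s x / ε) = 0
  · simp [hζx, weight]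
  have hp := hχ.prod_subset s hs x hx
  have hg : ∇ (φ s) x ≠ 0 := h.gradient_ne_zero _ hp
  -- on the support of the kernel, the cut-off is locally constant
  have hφε : |φ s x| ≤ ε := by
    have := abs_le.2 (hζsupp hζx)
    rwa [abs_div, abs_of_pos hε, div_le_one hε] at this
  have hχx := hχ1 s hs x hx hφε
  have hdiv : divergence (V s) x = divergence (fun y => a s y • normal (φ s) y) x := by
    refine divergence_congr ?_
    filter_upwards [hχx] with y hy
    simp [hVdef, cutoffField, hy]
  have hn := h.smooth.normal h.isOpen h.gradient_ne_zero
  have hnt := (hn.hasDerivAt h.isOpen hp).differentiableAt.hasDerivAt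
  have hat := (ha.hasDerivAt h.isOpen hp).differentiableAt.hasDerivAt
  set nt := deriv (fun r => normal (φ r) x) s
  -- `n` has constant length, so `n_t` is orthogonal to `n`
  have horth : inner ℝ (normal (φ s) x) nt = 0 := by
    have h1 := hnt.inner ℝ hnt
    have h2 : (fun r => inner ℝ (normal (φ r) x) (normal (φ r) x)) =ᶠ[𝓝 s] fun _ => (1 : ℝ) := by
      filter_upwards [(Continuous.prodMk_left x).continuousAt.eventually (h.isOpen.mem_nhds hp)]
        with r hr
      rw [real_inner_self_eq_norm_sq, norm_normal (h.gradient_ne_zero _ hr)]; simp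
    have h3 := h1.unique ((hasDerivAt_const s (1 : ℝ)).congr_of_eventuallyEq h2)
    rw [real_inner_comm (normal (φ s) x) nt] at h3
    linarith
  have hVtx : Vt s x = (χ x * a s x) • nt + (χ x * deriv (fun r => a r x) s) • normal (φ s) x :=
    ((hat.const_mul (χ x)).smul hnt).deriv
  have hφtx : deriv (fun r => φ r x) s = -(‖∇ (φ s) x‖ * inner ℝ (u s x) (normal (φ s) x)) := by
    have := h.transport s x hp
    rw [← norm_smul_normal hg, real_inner_smul_right] at this
    linarith
  have hχ1x : χ x = 1 := hχx.self_of_nhds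
  simp only [hVtx, hdiv, hφtx, map_add, map_smul, smul_eq_mul, fderiv_normal_self hg,
    fderiv_eq_norm_mul_inner hg nt, horth, hχ1x, weight, shapeRate]
  field_simp
  ring

end

/-! ### Time derivative of surface integrals -/

/-- If `A ε → J` pointwise on a ball around `t`, `(A ε)' (t) → K`, and the second derivatives of
`A ε` are bounded uniformly in `ε`, then `J' (t) = K`. No uniformity of the convergence is needed. -/
theorem hasDerivAt_of_tendsto_of_second_deriv_bound {J : ℝ → ℝ} {A B C : ℝ → ℝ → ℝ} {K M t r : ℝ}
    (hr : 0 < r)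
    (hA : ∀ᶠ ε in 𝓝[>] (0 : ℝ), ∀ s ∈ Metric.ball t r, HasDerivAt (A ε) (B ε s) s)
    (hB : ∀ᶠ ε in 𝓝[>] (0 : ℝ), ∀ s ∈ Metric.ball t r, HasDerivAt (B ε) (C ε s) s)
    (hC : ∀ᶠ ε in 𝓝[>] (0 : ℝ), ∀ s ∈ Metric.ball t r, |C ε s| ≤ M)
    (hJ : ∀ s ∈ Metric.ball t r, Tendsto (fun ε => A ε s) (𝓝[>] 0) (𝓝 (J s)))
    (hK : Tendsto (fun ε => B ε t) (𝓝[>] 0) (𝓝 K)) : HasDerivAt J K t := by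
  have ht : t ∈ Metric.ball t r := Metric.mem_ball_self hr
  have key : ∀ s ∈ Metric.ball t r, |J s - J t - (s - t) * K| ≤ M * |s - t| ^ 2 := by
    intro s hs
    have hlim := (((hJ s hs).sub (hJ t ht)).sub (hK.const_mul (s - t))).abs
    refine le_of_tendsto hlim ?_
    filter_upwards [hA, hB, hC] with ε hA hB hC
    have hsub : Metric.closedBall t |s - t| ⊆ Metric.ball t r :=
      Metric.closedBall_subset_ball hs
    have h1 : ∀ z ∈ Metric.closedBall t |s - t|, |B ε z - B ε t| ≤ M * |s - t| := by
      intro z hz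
      have := (convex_closedBall t |s - t|).norm_image_sub_le_of_norm_hasDerivWithin_le
        (fun y hy => (hB y (hsub hy)).hasDerivWithinAt) (fun y hy => hC y (hsub hy))
        (Metric.mem_closedBall_self (abs_nonneg _)) hz
      exact this.trans (mul_le_mul_of_nonneg_left hz ((abs_nonneg _).trans (hC t ht)))
    have h2 := (convex_closedBall t |s - t|).norm_image_sub_le_of_norm_hasDerivWithin_le
      (f := fun z => A ε z - z * B ε t) (f' := fun z => B ε z - 1 * B ε t)
      (fun y hy => ((hA y (hsub hy)).sub ((hasDerivAt_id y).mul_const _)).hasDerivWithinAt)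
      (fun y hy => by rw [one_mul]; exact h1 y hy)
      (Metric.mem_closedBall_self (abs_nonneg _)) (y := s)
      (by rw [Metric.mem_closedBall, Real.dist_eq])
    calc |A ε s - A ε t - (s - t) * B ε t| = ‖A ε s - s * B ε t - (A ε t - t * B ε t)‖ := by
          rw [Real.norm_eq_abs]; congr 1; ring
      _ ≤ M * |s - t| * ‖s - t‖ := h2
      _ = M * |s - t| ^ 2 := by rw [Real.norm_eq_abs]; ring
  rw [hasDerivAt_iff_isLittleO]
  refine Asymptotics.IsBigO.trans_isLittleO ?_ (Asymptotics.isLittleO_pow_sub_sub t one_lt_two)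
  refine Asymptotics.IsBigO.of_bound M ?_
  filter_upwards [Metric.ball_mem_nhds t hr] with s hs
  rw [Real.norm_eq_abs, norm_pow, norm_norm, Real.norm_eq_abs, smul_eq_mul]
  exact key s hs

section

variable {N : Set (ℝ × E3)} {φ : ℝ → E3 → ℝ} {u : ℝ → E3 → E3} {W : Set ℝ} {χ : E3 → ℝ}
  {a : ℝ → E3 → ℝ} {ζ : ℝ → ℝ} {s δ : ℝ}

theorem continuous_cutoff_mul (h : IsRegularTransport N φ u) (hχ : IsCutoff N W χ)
    (ha : SmoothOnSpacetime N a) (hs : s ∈ W) : Continuous (fun x => χ x * a s x) := by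
  refine ContinuousOn.continuous_of_tsupport_subset (s := {x | (s, x) ∈ N}) ?_
    (h.isOpen.preimage (Continuous.prodMk_right s))
    ((tsupport_mul_subset_left (f := χ) (g := a s)).trans (hχ.prod_subset s hs))
  exact hχ.smooth.continuous.continuousOn.mul
    (ha.continuousOn.comp (f := fun x => (s, x)) (by fun_prop) fun x hx => hx)

theorem tendsto_integral_cutoff_mul_weight (h : IsRegularTransport N φ u) (hχ : IsCutoff N W χ)
    (ha : SmoothOnSpacetime N a) (hζ : Continuous ζ) (hζ0 : ∀ r, 0 ≤ ζ r)
    (hζsupp : Function.support ζ ⊆ Icc (-1) 1) (hζ1 : ∫ r, ζ r = 1) (hs : s ∈ W) :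
    SurfaceIntegrable (φ s) (fun x => χ x * a s x) ∧
      Tendsto (fun ε => ∫ x, χ x * a s x * weight ζ ε (φ s) x) (𝓝[>] 0)
        (𝓝 (surfaceIntegral (φ s) (fun x => χ x * a s x))) :=
  tendsto_integral_weight (h.isOpen.preimage (Continuous.prodMk_right s))
    (fun _ hx => ((h.smooth.space_contDiffAt h.isOpen hx).of_le (by norm_cast)).contDiffWithinAt)
    (fun _ hx => h.gradient_ne_zero _ hx) hζ hζ0 hζsupp hζ1 (continuous_cutoff_mul h hχ ha hs)
    hχ.hasCompactSupport.mul_right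
    ((tsupport_mul_subset_left (f := χ) (g := a s)).trans (hχ.prod_subset s hs))

theorem hasDerivAt_surfaceIntegral_cutoff (h : IsRegularTransport N φ u) (hχ : IsCutoff N W χ)
    (ha : SmoothOnSpacetime N a) (hζ : Continuous ζ) (hζ0 : ∀ r, 0 ≤ ζ r)
    (hζsupp : Function.support ζ ⊆ Icc (-1) 1) (hζ1 : ∫ r, ζ r = 1) (hδ : 0 < δ)
    (hχ1 : ∀ s ∈ W, ∀ x ∈ tsupport χ, |φ s x| ≤ δ → χ =ᶠ[𝓝 x] 1) (hs : s ∈ W) :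
    HasDerivAt (fun r => surfaceIntegral (φ r) (fun x => χ x * a r x))
      (surfaceIntegral (φ s) (fun x => χ x * shapeRate φ u a s x)) s := by
  have hb := smooth_shapeRate h ha
  have hc := smooth_shapeRate h hb
  obtain ⟨r, hr, hrW, M, hM⟩ := exists_bound_integral_cutoff_mul_weight h hχ hc hζ hζ0 hζ1 hs
  have hsmall : ∀ᶠ ε in 𝓝[>] (0 : ℝ), 0 < ε ∧ ε ≤ δ :=
    Ioc_mem_nhdsGT hδ
  have hD : ∀ {b : ℝ → E3 → ℝ}, SmoothOnSpacetime N b → ∀ᶠ ε in 𝓝[>] (0 : ℝ),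
      ∀ s' ∈ Metric.ball s r, HasDerivAt (fun r => ∫ x, χ x * b r x * weight ζ ε (φ r) x)
        (∫ x, χ x * shapeRate φ u b s' x * weight ζ ε (φ s') x) s' := fun hb => by
    filter_upwards [hsmall] with ε hε s' hs'
    exact hasDerivAt_integral_cutoff_mul_weight h hχ hb hζ hζ0 hζ1 hζsupp hε.1
      (fun s hs x hx hφ => hχ1 s hs x hx (hφ.trans hε.2)) (hrW hs')
  exact hasDerivAt_of_tendsto_of_second_deriv_bound hr (hD ha) (hD hb)
    (Eventually.of_forall fun ε s' hs' => hM s' hs' ε)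
    (fun s' hs' => (tendsto_integral_cutoff_mul_weight h hχ ha hζ hζ0 hζsupp hζ1 (hrW hs')).2)
    (tendsto_integral_cutoff_mul_weight h hχ hb hζ hζ0 hζsupp hζ1 hs).2

/-! ### The surface Reynolds formula -/

/-- The integrand `a_t + u · ∇a + a div_{∂Ω} u` of the surface Reynolds formula. -/
noncomputable def reynoldsRate (φ : ℝ → E3 → ℝ) (u : ℝ → E3 → E3) (a : ℝ → E3 → ℝ)
    (s : ℝ) (x : E3) : ℝ :=
  deriv (fun r => a r x) s + inner ℝ (u s x) (∇ (a s) x) +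
    a s x * tangentialDivergence (φ s) (u s) x

theorem smooth_reynoldsRate (h : IsRegularTransport N φ u) (ha : SmoothOnSpacetime N a) :
    SmoothOnSpacetime N (reynoldsRate φ u a) := by
  have hn := h.smooth.normal h.isOpen h.gradient_ne_zero
  have hu := h.smooth_velocity
  exact ((ha.deriv h.isOpen).add (hu.inner ℝ (ha.gradient h.isOpen))).add
    (ha.mul ((hu.divergence h.isOpen).sub (((hu.fderiv h.isOpen).clm_apply hn).inner ℝ hn)))

theorem fderiv_norm_apply {p : E3 → E3} {x : E3} (hp : DifferentiableAt ℝ p x) (h0 : p x ≠ 0)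
    (v : E3) :
    ‖p x‖ * fderiv ℝ (fun y => ‖p y‖) x v = inner ℝ (p x) (fderiv ℝ p x v) := by
  have h1 := hp.hasFDerivAt.norm_sq
  have h2 := ((hp.norm ℝ h0).hasFDerivAt).pow 2
  have := congrArg (fun L : E3 →L[ℝ] ℝ => L v) (h1.unique h2)
  simp at this
  linarith

theorem inner_fderiv_gradient {ψ : E3 → ℝ} {x : E3} (hψ : ContDiffAt ℝ 2 ψ x) (v w : E3) :
    inner ℝ (fderiv ℝ (∇ ψ) x v) w = fderiv ℝ (fderiv ℝ ψ) x v w := by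
  have h1 : HasFDerivAt (fderiv ℝ ψ) (fderiv ℝ (fderiv ℝ ψ) x) x :=
    ((hψ.fderiv_right (m := 1) (by norm_num)).differentiableAt one_ne_zero).hasFDerivAt
  have h2 : HasFDerivAt (∇ ψ) _ x :=
    (InnerProductSpace.toDual ℝ E3).symm.toContinuousLinearEquiv.hasFDerivAt.comp x h1
  rw [h2.fderiv]
  simp

theorem inner_fderiv_gradient_comm {ψ : E3 → ℝ} {x : E3} (hψ : ContDiffAt ℝ 2 ψ x) (v w : E3) :
    inner ℝ (fderiv ℝ (∇ ψ) x v) w = inner ℝ (fderiv ℝ (∇ ψ) x w) v := by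
  rw [inner_fderiv_gradient hψ, inner_fderiv_gradient hψ]
  exact hψ.isSymmSndFDerivAt (by simp) v w

theorem differentiableAt_gradient {ψ : E3 → ℝ} {x : E3} (hψ : ContDiffAt ℝ 2 ψ x) :
    DifferentiableAt ℝ (∇ ψ) x :=
  (InnerProductSpace.toDual ℝ E3).symm.toContinuousLinearEquiv.differentiableAt.comp x
    ((hψ.fderiv_right (m := 1) (by norm_num)).differentiableAt one_ne_zero)

theorem differentiableAt_normal {ψ : E3 → ℝ} {x : E3} (hψ : ContDiffAt ℝ 2 ψ x) (h0 : ∇ ψ x ≠ 0) :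
    DifferentiableAt ℝ (normal ψ) x :=
  (((differentiableAt_gradient hψ).norm ℝ h0).inv (norm_ne_zero_iff.2 h0)).smul
    (differentiableAt_gradient hψ)

theorem divergence_sub {v w : E3 → E3} {x : E3} (hv : DifferentiableAt ℝ v x)
    (hw : DifferentiableAt ℝ w x) :
    divergence (fun y => v y - w y) x = divergence v x - divergence w x := by
  unfold LevelSetShape.divergence
  rw [fderiv_fun_sub hv hw, ← Finset.sum_sub_distrib]
  simp

/-- The vector field `F |∇ψ| (w - (w · n) n)`, tangent to the level sets of `ψ`. It is written with
`(w · ∇ψ) F n` as its second term, which has simpler derivatives. -/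
noncomputable def tangentialFlux (ψ F : E3 → ℝ) (w : E3 → E3) (x : E3) : E3 :=
  (F x * ‖∇ ψ x‖) • w x - inner ℝ (w x) (∇ ψ x) • (F x • normal ψ x)

theorem fderiv_tangentialFlux {ψ F : E3 → ℝ} {w : E3 → E3} {x : E3} (h0 : ∇ ψ x ≠ 0) :
    fderiv ℝ ψ x (tangentialFlux ψ F w x) = 0 := by
  rw [tangentialFlux, map_sub, map_smul, map_smul, map_smul, fderiv_normal_self h0,
    ← inner_gradient_left, real_inner_comm]
  simp only [smul_eq_mul]
  ring

/-- The divergence of the tangential flux is `|∇ψ|` times the difference of the Reynolds and shape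
integrands. The second derivatives of `ψ` cancel because the Hessian is symmetric. -/
theorem divergence_tangentialFlux {ψ F : E3 → ℝ} {w : E3 → E3} {x : E3}
    (hψ : ContDiffAt ℝ 2 ψ x) (h0 : ∇ ψ x ≠ 0) (hF : DifferentiableAt ℝ F x)
    (hw : DifferentiableAt ℝ w x) :
    divergence (tangentialFlux ψ F w) x = ‖∇ ψ x‖ *
      (inner ℝ (w x) (∇ F x) + F x * tangentialDivergence ψ w x -
        divergence (fun y => F y • normal ψ y) x * inner ℝ (w x) (normal ψ x)) := by
  have hp := differentiableAt_gradient hψ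
  have hn := differentiableAt_normal hψ h0
  have hFn : DifferentiableAt ℝ (fun y => F y • normal ψ y) x := hF.smul hn
  have hpn : DifferentiableAt ℝ (fun y => ‖∇ ψ y‖) x := hp.norm ℝ h0
  have hFp : DifferentiableAt ℝ (fun y => F y * ‖∇ ψ y‖) x := hF.mul hpn
  have hwp : DifferentiableAt ℝ (fun y => inner ℝ (w y) (∇ ψ y)) x := hw.inner ℝ hp
  have hsub : divergence (tangentialFlux ψ F w) x =
      divergence (fun y => (F y * ‖∇ ψ y‖) • w y) x -
        divergence (fun y => inner ℝ (w y) (∇ ψ y) • (F y • normal ψ y)) x :=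
    divergence_sub (hFp.smul hw) (hwp.smul hFn)
  rw [hsub, divergence_smul hFp hw, divergence_smul hwp hFn]
  have e1 : fderiv ℝ (fun y => F y * ‖∇ ψ y‖) x (w x) =
      F x * fderiv ℝ (fun y => ‖∇ ψ y‖) x (w x) + ‖∇ ψ x‖ * inner ℝ (w x) (∇ F x) := by
    rw [fderiv_fun_mul hF hpn, ← real_inner_comm, inner_gradient_left]
    simp
  have e2 : fderiv ℝ (fun y => inner ℝ (w y) (∇ ψ y)) x (F x • normal ψ x) =
      F x * (inner ℝ (w x) (fderiv ℝ (∇ ψ) x (normal ψ x)) +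
        inner ℝ (fderiv ℝ w x (normal ψ x)) (∇ ψ x)) := by
    rw [map_smul, fderiv_inner_apply ℝ hw hp, smul_eq_mul]
  have e3 : fderiv ℝ (fun y => ‖∇ ψ y‖) x (w x) =
      inner ℝ (w x) (fderiv ℝ (∇ ψ) x (normal ψ x)) := by
    have h1 := fderiv_norm_apply hp h0 (w x)
    have hne : ‖∇ ψ x‖ ≠ 0 := norm_ne_zero_iff.2 h0
    rw [real_inner_comm, inner_fderiv_gradient_comm hψ] at h1
    rw [normal, map_smul, real_inner_smul_right, real_inner_comm, ← h1, inv_mul_cancel_left₀ hne]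
  have e4 : inner ℝ (fderiv ℝ w x (normal ψ x)) (∇ ψ x) =
      ‖∇ ψ x‖ * inner ℝ (fderiv ℝ w x (normal ψ x)) (normal ψ x) := by
    conv_lhs => rw [← norm_smul_normal h0, real_inner_smul_right]
  have e5 : inner ℝ (w x) (∇ ψ x) = ‖∇ ψ x‖ * inner ℝ (w x) (normal ψ x) := by
    conv_lhs => rw [← norm_smul_normal h0, real_inner_smul_right]
  rw [e1, e2, e3, e4, e5, tangentialDivergence]
  ring
end

theorem exists_smooth_kernel : ∃ ζ : ℝ → ℝ, ContDiff ℝ ∞ ζ ∧ (∀ r, 0 ≤ ζ r) ∧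
    Function.support ζ ⊆ Icc (-1) 1 ∧ ∫ r, ζ r = 1 := by
  let b : ContDiffBump (0 : ℝ) := ⟨1 / 2, 1, by norm_num, by norm_num⟩
  refine ⟨b.normed volume, b.contDiff_normed, b.nonneg_normed, ?_, b.integral_normed⟩
  rw [b.support_normed_eq, Real.ball_eq_Ioo]
  simpa [b] using Ioo_subset_Icc_self

section

variable {N : Set (ℝ × E3)} {φ : ℝ → E3 → ℝ} {u : ℝ → E3 → E3} {W : Set ℝ} {χ : E3 → ℝ}
  {a : ℝ → E3 → ℝ} {s δ : ℝ}

theorem integral_cutoff_mul_reynoldsRate_sub_shapeRate_eq_zero (h : IsRegularTransport N φ u)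
    (hχ : IsCutoff N W χ)
    (ha : SmoothOnSpacetime N a) {ζ : ℝ → ℝ} (hζ : ContDiff ℝ 1 ζ)
    (hζsupp : Function.support ζ ⊆ Icc (-1) 1) {ε : ℝ} (hε : 0 < ε)
    (hχ1 : ∀ s ∈ W, ∀ x ∈ tsupport χ, |φ s x| ≤ ε → χ =ᶠ[𝓝 x] 1) (hs : s ∈ W) :
    ∫ x, χ x * (reynoldsRate φ u a s x - shapeRate φ u a s x) * weight ζ ε (φ s) x = 0 := by
  have hn := h.smooth.normal h.isOpen h.gradient_ne_zero
  have hgrad := h.smooth.gradient h.isOpen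
  have hw : SmoothOnSpacetime N (fun s => tangentialFlux (φ s) (a s) (u s)) :=
    ((ha.mul (hgrad.norm ℝ h.gradient_ne_zero)).smul h.smooth_velocity).sub
      ((h.smooth_velocity.inner ℝ hgrad).smul (ha.smul hn))
  let v : E3 → E3 := fun x => χ x • tangentialFlux (φ s) (a s) (u s) x
  have hvχ : tsupport v ⊆ tsupport χ := tsupport_smul_subset_left _ _
  have hibp := integral_kernel_mul_fderiv_eq h hζ
    (fun r => (hζ.differentiable one_ne_zero r).hasDerivAt) (v := v)
    (fun x hx => hχ.prod_subset s hs x (hvχ hx))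
    (fun x hx => ((hχ.smooth.contDiffAt.smul (hw.space_contDiffAt h.isOpen hx)).of_le
      (by norm_cast)))
    (hχ.hasCompactSupport.mono' (subset_closure.trans hvχ)) ε
  -- the kernel plays the role of the primitive here, and the flux is tangent to the level sets
  have hzero : ∀ x, (ε⁻¹ * deriv ζ (φ s x / ε)) * fderiv ℝ (φ s) x (v x) = 0 := by
    intro x
    by_cases hx : x ∈ tsupport χ
    · rw [show v x = χ x • tangentialFlux (φ s) (a s) (u s) x from rfl, map_smul,
        fderiv_tangentialFlux (h.gradient_ne_zero _ (hχ.prod_subset s hs x hx)), smul_zero,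
        mul_zero]
    · simp [v, image_eq_zero_of_notMem_tsupport hx]
  simp only [hzero, integral_zero, zero_eq_neg] at hibp
  have hpt : ∀ x, χ x * (reynoldsRate φ u a s x - shapeRate φ u a s x) * weight ζ ε (φ s) x =
      ε⁻¹ * (divergence v x * ζ (φ s x / ε)) := by
    intro x
    by_cases hx : x ∈ tsupport χ
    swap
    · have : divergence v x = 0 := by
        by_contra h; exact hx (hvχ (support_divergence_subset _ h))
      simp [this, image_eq_zero_of_notMem_tsupport hx]
    by_cases hζx : ζ (φ s x / ε) = 0
    · simp [hζx, weight]
    have hp := hχ.prod_subset s hs x hx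
    have hφε : |φ s x| ≤ ε := by
      have := abs_le.2 (hζsupp hζx)
      rwa [abs_div, abs_of_pos hε, div_le_one hε] at this
    have hχx := hχ1 s hs x hx hφε
    have hdiv : divergence v x = divergence (tangentialFlux (φ s) (a s) (u s)) x := by
      refine divergence_congr ?_
      filter_upwards [hχx] with y hy
      simp [v, hy]
    have hχ1x : χ x = 1 := hχx.self_of_nhds
    rw [hdiv, divergence_tangentialFlux
      ((h.smooth.space_contDiffAt h.isOpen hp).of_le (by norm_cast)) (h.gradient_ne_zero _ hp)
      ((ha.space_contDiffAt h.isOpen hp).differentiableAt (by simp))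
      ((h.smooth_velocity.space_contDiffAt h.isOpen hp).differentiableAt (by simp)), hχ1x]
    simp only [reynoldsRate, shapeRate, weight]
    ring
  simp only [hpt]
  rw [integral_const_mul, hibp, mul_zero]

theorem surfaceIntegral_reynoldsRate_eq (h : IsRegularTransport N φ u) (hχ : IsCutoff N W χ)
    (ha : SmoothOnSpacetime N a) (hδ : 0 < δ)
    (hχ1 : ∀ s ∈ W, ∀ x ∈ tsupport χ, |φ s x| ≤ δ → χ =ᶠ[𝓝 x] 1) (hs : s ∈ W) :
    surfaceIntegral (φ s) (fun x => χ x * reynoldsRate φ u a s x) =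
      surfaceIntegral (φ s) (fun x => χ x * shapeRate φ u a s x) := by
  -- the surface integrals do not depend on the kernel, so a smooth one may be used
  obtain ⟨ζ, hζ, hζ0, hζsupp, hζ1⟩ := exists_smooth_kernel
  have hr := smooth_reynoldsRate h ha
  have hm := smooth_shapeRate h ha
  have h1 := tendsto_integral_cutoff_mul_weight h hχ hr hζ.continuous hζ0 hζsupp hζ1 hs
  have h2 := tendsto_integral_cutoff_mul_weight h hχ hm hζ.continuous hζ0 hζsupp hζ1 hs
  have h3 := (tendsto_integral_cutoff_mul_weight h hχ
    (a := fun s x => reynoldsRate φ u a s x - shapeRate φ u a s x) (hr.sub hm)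
    hζ.continuous hζ0 hζsupp hζ1 hs).2
  have h4 : surfaceIntegral (φ s)
      (fun x => χ x * (reynoldsRate φ u a s x - shapeRate φ u a s x)) = 0 := by
    refine tendsto_nhds_unique h3 (tendsto_const_nhds.congr' ?_)
    filter_upwards [Ioc_mem_nhdsGT hδ] with ε hε
    exact (integral_cutoff_mul_reynoldsRate_sub_shapeRate_eq_zero h hχ ha
      (hζ.of_le (by norm_cast)) hζsupp hε.1
      (fun s hs x hx hφ => hχ1 s hs x hx (hφ.trans hε.2)) hs).symm
  simp only [mul_sub] at h4
  rw [surfaceIntegral, integral_sub h1.1 h2.1] at h4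
  exact sub_eq_zero.1 h4

end

/-! ### Cutting off near the level sets -/

theorem exists_smooth_cutoff {C O : Set E3} (hC : IsCompact C) (hO : IsOpen O) (hCO : C ⊆ O) :
    ∃ χ : E3 → ℝ, ContDiff ℝ ∞ χ ∧ HasCompactSupport χ ∧ tsupport χ ⊆ O ∧
      ∀ x ∈ C, χ =ᶠ[𝓝 x] 1 := by
  obtain ⟨L, hL, hCL, hLO⟩ := exists_compact_between hC hO hCO
  obtain ⟨χ, h1, h0, -⟩ := exists_contMDiffMap_one_nhds_of_subset_interior (n := (⊤ : ℕ∞))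
    (modelWithCornersSelf ℝ E3) hC.isClosed hCL
  have hsupp : tsupport χ ⊆ L :=
    closure_minimal (fun x hx => by_contra fun h => hx (h0 x h)) hL.isClosed
  exact ⟨χ, χ.contMDiff.contDiff, hL.of_isClosed_subset (isClosed_tsupport _) hsupp,
    hsupp.trans hLO, fun x hx => (eventually_nhdsSet_iff_forall.1 h1) x hx⟩

/-- A cut-off equal to `1` near the thin tubes around the level sets, for all times near `t`, and
supported where `∇φ ≠ 0`. -/
theorem exists_cutoff {I : Set ℝ} (hI : IsOpen I) {Q : Set E3} (hQ : IsOpen Q)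
    {φ : ℝ → E3 → ℝ} (hφ : SmoothOnSpacetime (I ×ˢ Q) φ) {t : ℝ} (ht : t ∈ I)
    (hreg : ∀ x, φ t x = 0 → ∇ (φ t) x ≠ 0)
    (htube : ∃ K : Set E3, IsCompact K ∧ K ⊆ Q ∧ ∃ δ > 0, ∀ᶠ s in 𝓝 t,
      ∀ x ∈ Q, |φ s x| ≤ δ → x ∈ K) :
    ∃ (W : Set ℝ) (χ : E3 → ℝ) (δ : ℝ), t ∈ W ∧ 0 < δ ∧
      IsCutoff ((I ×ˢ Q) ∩ {p | ∇ (φ p.1) p.2 ≠ 0}) W χ ∧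
      ∀ s ∈ W, ∀ x ∈ Q, |φ s x| ≤ δ → χ =ᶠ[𝓝 x] 1 := by
  obtain ⟨K, hK, hKQ, δ₀, hδ₀, hKδ⟩ := htube
  have hIQ : IsOpen (I ×ˢ Q) := hI.prod hQ
  have hN : IsOpen ((I ×ˢ Q) ∩ {p | ∇ (φ p.1) p.2 ≠ 0}) :=
    (hφ.gradient hIQ).continuousOn.isOpen_inter_preimage hIQ isOpen_compl_singleton
  set N := (I ×ˢ Q) ∩ {p | ∇ (φ p.1) p.2 ≠ 0}
  have hslice : MapsTo (fun x : E3 => (t, x)) K (I ×ˢ Q) := fun x hx => ⟨ht, hKQ hx⟩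
  have hgK : ContinuousOn (∇ (φ t)) K :=
    (hφ.gradient hIQ).continuousOn.comp (f := fun x => (t, x)) (by fun_prop) hslice
  have hφK : ContinuousOn (φ t) K :=
    hφ.continuousOn.comp (f := fun x => (t, x)) (by fun_prop) hslice
  have hcrit : IsCompact (K ∩ {x | ∇ (φ t) x = 0}) :=
    hK.of_isClosed_subset (hgK.preimage_isClosed_of_isClosed hK.isClosed isClosed_singleton)
      inter_subset_left
  -- on the compact set of critical points in the tube, `|φ t|` is bounded below
  obtain ⟨m, hm, hmin⟩ := hcrit.exists_forall_le' (a := (0 : ℝ)) (f := fun x => |φ t x|)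
    ((hφK.mono inter_subset_left).abs) fun x hx => abs_pos.2 fun h0 => hreg x h0 hx.2
  have hC : IsCompact (K ∩ {x | |φ t x| ≤ m / 2}) :=
    hK.of_isClosed_subset (hφK.abs.preimage_isClosed_of_isClosed hK.isClosed isClosed_Iic)
      inter_subset_left
  obtain ⟨χ, hχ, hχc, hχN, hχ1⟩ := exists_smooth_cutoff hC
    (hN.preimage (Continuous.prodMk_right t)) fun x hx => ⟨⟨ht, hKQ hx.1⟩, fun h0 => by
      have h1 := hmin x ⟨hx.1, h0⟩
      have h2 : |φ t x| ≤ m / 2 := hx.2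
      linarith⟩
  have hev1 : ∀ᶠ s in 𝓝 t, ∀ x ∈ tsupport χ, (s, x) ∈ N :=
    hχc.isCompact.eventually_forall_of_forall_eventually fun x hx => hN.mem_nhds (hχN hx)
  have hev2 : ∀ᶠ s in 𝓝 t, ∀ x ∈ K, |φ s x - φ t x| < m / 4 := by
    refine hK.eventually_forall_of_forall_eventually fun x hx => ?_
    have hc : ContinuousAt (fun p : ℝ × E3 => φ p.1 p.2) (t, x) :=
      (hφ.contDiffAt hIQ ⟨ht, hKQ hx⟩).continuousAt
    have hc2 : ContinuousAt (fun p : ℝ × E3 => φ t p.2) (t, x) :=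
      ContinuousAt.comp (g := φ t) (f := Prod.snd)
        (hφ.space_contDiffAt hIQ ⟨ht, hKQ hx⟩).continuousAt continuousAt_snd
    refine (hc.sub hc2).abs.eventually (gt_mem_nhds ?_)
    simpa using by positivity
  obtain ⟨W, hW, hWo, htW⟩ := eventually_nhds_iff.1 (hev1.and (hev2.and hKδ))
  refine ⟨W, χ, min δ₀ (m / 4), htW, by positivity, ⟨hWo, hχ, hχc, fun s hs => (hW s hs).1⟩,
    fun s hs x hx hφx => hχ1 x ?_⟩
  have hxK := (hW s hs).2.2 x hx (hφx.trans (min_le_left _ _))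
  refine ⟨hxK, ?_⟩
  have h1 := (hW s hs).2.1 x hxK
  have h2 := hφx.trans (min_le_right _ _)
  have h3 := abs_sub_abs_le_abs_sub (φ t x) (φ s x)
  rw [abs_sub_comm] at h3
  change |φ t x| ≤ m / 2
  linarith

/-- The cut-off does not change the regularized integral, as it is `1` where the kernel is
nonzero. -/
theorem integrableOn_and_setIntegral_mul_weight_eq {Q : Set E3} (hQ : IsOpen Q) {ψ : E3 → ℝ}
    {χ : E3 → ℝ} (hχQ : tsupport χ ⊆ Q) {ζ : ℝ → ℝ} (hζsupp : Function.support ζ ⊆ Icc (-1) 1)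
    {ε : ℝ} (hε : 0 < ε) (hχ1 : ∀ x ∈ Q, |ψ x| ≤ ε → χ x = 1) {b : E3 → ℝ}
    (hint : Integrable (fun x => χ x * b x * weight ζ ε ψ x)) :
    IntegrableOn (fun x => b x * weight ζ ε ψ x) Q ∧
      ∫ x in Q, b x * weight ζ ε ψ x = ∫ x, χ x * b x * weight ζ ε ψ x := by
  have heq : EqOn (fun x => χ x * b x * weight ζ ε ψ x) (fun x => b x * weight ζ ε ψ x) Q := by
    intro x hx
    by_cases hζx : ζ (ψ x / ε) = 0
    · simp [weight, hζx]
    · have h1 := abs_le.2 (hζsupp hζx)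
      rw [abs_div, abs_of_pos hε, div_le_one hε] at h1
      simp [hχ1 x hx h1]
  refine ⟨hint.integrableOn.congr_fun heq hQ.measurableSet, ?_⟩
  rw [← setIntegral_congr_fun hQ.measurableSet heq]
  refine setIntegral_eq_integral_of_forall_compl_eq_zero fun x hx => ?_
  rw [image_eq_zero_of_notMem_tsupport fun h => hx (hχQ h), zero_mul, zero_mul]

end LevelSetShape

theorem mainTheorem4 (k : ℕ) (f : Jet k → ℝ) (hf : ContDiffOn ℝ ∞ f (regularJets k))
    (I : Set ℝ) (hI : IsOpen I) (Q : Set E3) (hQ : IsOpen Q)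
    (φ : ℝ → E3 → ℝ) (u : ℝ → E3 → E3)
    (hφ : ContDiffOn ℝ ∞ (fun p : ℝ × E3 => φ p.1 p.2) (I ×ˢ Q))
    (hu : ContDiffOn ℝ ∞ (fun p : ℝ × E3 => u p.1 p.2) (I ×ˢ Q))
    -- transport equation `φ_t + u · ∇φ = 0`
    (htransport : ∀ t ∈ I, ∀ x ∈ Q,
      deriv (fun s => φ s x) t + inner ℝ (u t x) (∇ (φ t) x) = 0)
    -- the zero level sets are regular and contained in `Q`
    (hreg : ∀ t ∈ I, ∀ x, φ t x = 0 → ∇ (φ t) x ≠ 0)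
    (hzero : ∀ t ∈ I, ∀ x, φ t x = 0 → x ∈ Q)
    -- locally in time, a thin tube around the surface stays in a fixed compact subset of `Q`
    (htube : ∀ t ∈ I, ∃ K : Set E3, IsCompact K ∧ K ⊆ Q ∧ ∃ δ > 0, ∀ᶠ s in 𝓝 t,
      ∀ x ∈ Q, |φ s x| ≤ δ → x ∈ K)
    -- the cut-off function
    (ζ : ℝ → ℝ) (hζ : Continuous ζ) (hζ0 : ∀ r, 0 ≤ ζ r)
    (hζsupp : Function.support ζ ⊆ Icc (-1) 1) (hζ1 : ∫ r, ζ r = 1) :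
    ∀ t ∈ I,
      -- shape derivative formula
      (SurfaceIntegrable (φ t) (density f (φ t)) ∧
        SurfaceIntegrable (φ t) (shapeIntegrand f φ u t) ∧
        HasDerivAt (fun s => J f (φ s)) (surfaceIntegral (φ t) (shapeIntegrand f φ u t)) t) ∧
      -- surface Reynolds formula
      (SurfaceIntegrable (φ t) (reynoldsIntegrand f φ u t) ∧
        HasDerivAt (fun s => J f (φ s))
          (surfaceIntegral (φ t) (reynoldsIntegrand f φ u t)) t) ∧
      -- exact derivative of the regularized functional, for all small `ε`
      (∀ᶠ ε in 𝓝[>] (0 : ℝ), ∀ᶠ s in 𝓝 t,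
        IntegrableOn (fun x => density f (φ s) x * weight ζ ε (φ s) x) Q ∧
        IntegrableOn (fun x => shapeIntegrand f φ u s x * weight ζ ε (φ s) x) Q ∧
        HasDerivAt (fun r => Jreg f Q ζ ε (φ r))
          (∫ x in Q, shapeIntegrand f φ u s x * weight ζ ε (φ s) x) s) ∧
      -- passage to the limit `ε → 0`
      Tendsto (fun ε => Jreg f Q ζ ε (φ t)) (𝓝[>] 0) (𝓝 (J f (φ t))) ∧
      Tendsto (fun ε => deriv (fun r => Jreg f Q ζ ε (φ r)) t) (𝓝[>] 0)
        (𝓝 (deriv (fun r => J f (φ r)) t)) ∧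
      Tendsto (fun ε => ∫ x in Q, shapeIntegrand f φ u t x * weight ζ ε (φ t) x) (𝓝[>] 0)
        (𝓝 (surfaceIntegral (φ t) (shapeIntegrand f φ u t))) := by
  intro t ht
  obtain ⟨W, χ, δ, htW, hδ, hχ, hχ1⟩ := exists_cutoff hI hQ hφ ht (hreg t ht) (htube t ht)
  have hIQ : IsOpen (I ×ˢ Q) := hI.prod hQ
  have hφ' : SmoothOnSpacetime (I ×ˢ Q) φ := hφ
  set N := (I ×ˢ Q) ∩ {p | ∇ (φ p.1) p.2 ≠ 0} with hNdef
  have hNQ : N ⊆ I ×ˢ Q := inter_subset_left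
  have h : IsRegularTransport N φ u :=
    { isOpen := (hφ'.gradient hIQ).continuousOn.isOpen_inter_preimage hIQ isOpen_compl_singleton
      smooth := hφ.mono hNQ
      smooth_velocity := hu.mono hNQ
      gradient_ne_zero := fun p hp => hp.2
      transport := fun s x hp => htransport s hp.1.1 x hp.1.2 }
  let F : ℝ → E3 → ℝ := fun s => density f (φ s)
  have hF : SmoothOnSpacetime N F := h.smooth.density hf h.isOpen h.gradient_ne_zero
  have hS : SmoothOnSpacetime N (shapeIntegrand f φ u) := smooth_shapeRate h hF
  have hR : SmoothOnSpacetime N (reynoldsIntegrand f φ u) := smooth_reynoldsRate h hF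
  -- restrict to times in `I`, where the hypotheses on the level sets apply
  have hχ' : IsCutoff N (W ∩ I) χ := ⟨hχ.isOpen.inter hI, hχ.smooth, hχ.hasCompactSupport,
    fun s hs => hχ.prod_subset s hs.1⟩
  have htWI : t ∈ W ∩ I := ⟨htW, ht⟩
  have hχQ : tsupport χ ⊆ Q := fun x hx => (hχ.prod_subset t htW x hx).1.2
  have hχ1' : ∀ s ∈ W ∩ I, ∀ x ∈ tsupport χ, |φ s x| ≤ δ → χ =ᶠ[𝓝 x] 1 := fun s hs x hx =>
    hχ1 s hs.1 x (hχQ hx)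
  have hmeas : ∀ s ∈ W ∩ I, MeasurableSet {x | φ s x = 0} := fun s hs => by
    rw [← inter_eq_right.2 (hzero s hs.2)]
    exact measurableSet_inter_zeroLevel hQ (hφ.continuousOn.comp (f := fun x => (s, x))
      (by fun_prop) fun x hx => ⟨hs.2, hx⟩)
  have heq : ∀ s ∈ W ∩ I, ∀ b : E3 → ℝ, EqOn (fun x => χ x * b x) b {x | φ s x = 0} := by
    intro s hs b x hx
    have hx0 : φ s x = 0 := hx
    have := (hχ1 s hs.1 x (hzero s hs.2 x hx0) (by rw [hx0, abs_zero]; exact hδ.le)).self_of_nhds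
    simp [this]
  have hsurf : ∀ s ∈ W ∩ I, ∀ b : E3 → ℝ,
      surfaceIntegral (φ s) (fun x => χ x * b x) = surfaceIntegral (φ s) b := fun s hs b =>
    setIntegral_congr_fun (hmeas s hs) (heq s hs b)
  have hsint : ∀ {b : ℝ → E3 → ℝ}, SmoothOnSpacetime N b → SurfaceIntegrable (φ t) (b t) :=
    fun hb => ((tendsto_integral_cutoff_mul_weight h hχ' hb hζ hζ0 hζsupp hζ1 htWI).1).congr_fun
      (heq t htWI _) (hmeas t htWI)
  have hQint : ∀ {b : ℝ → E3 → ℝ}, SmoothOnSpacetime N b → ∀ s ∈ W ∩ I, ∀ ε ∈ Ioc 0 δ,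
      IntegrableOn (fun x => b s x * weight ζ ε (φ s) x) Q ∧
      ∫ x in Q, b s x * weight ζ ε (φ s) x = ∫ x, χ x * b s x * weight ζ ε (φ s) x := by
    intro b hb s hs ε hε
    refine integrableOn_and_setIntegral_mul_weight_eq hQ hχQ hζsupp hε.1
      (fun x hx hφx => (hχ1 s hs.1 x hx (hφx.trans hε.2)).self_of_nhds) ?_
    refine Continuous.integrable_of_hasCompactSupport
      (continuous_mul_weight (h.isOpen.preimage (Continuous.prodMk_right s))
        (fun x hx => ((h.smooth.space_contDiffAt h.isOpen hx).of_le
          (by norm_cast)).contDiffWithinAt) hζ (continuous_cutoff_mul h hχ' hb hs).continuousOn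
        ((tsupport_mul_subset_left (f := χ) (g := b s)).trans (hχ'.prod_subset s hs)) ε)
      (hχ.hasCompactSupport.mul_right.mul_right)
  have hlim : ∀ {b : ℝ → E3 → ℝ}, SmoothOnSpacetime N b →
      Tendsto (fun ε => ∫ x in Q, b t x * weight ζ ε (φ t) x) (𝓝[>] 0)
        (𝓝 (surfaceIntegral (φ t) (b t))) := by
    intro b hb
    rw [← hsurf t htWI]
    refine (tendsto_integral_cutoff_mul_weight h hχ' hb hζ hζ0 hζsupp hζ1 htWI).2.congr' ?_
    filter_upwards [Ioc_mem_nhdsGT hδ] with ε hε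
    exact (hQint hb t htWI ε hε).2.symm
  have hnear : ∀ s ∈ W ∩ I, W ∩ I ∈ 𝓝 s := fun s hs => hχ'.isOpen.mem_nhds hs
  have hJ : HasDerivAt (fun s => J f (φ s)) (surfaceIntegral (φ t) (shapeIntegrand f φ u t)) t := by
    have h1 := hasDerivAt_surfaceIntegral_cutoff h hχ' hF hζ hζ0 hζsupp hζ1 hδ hχ1' htWI
    rw [hsurf t htWI] at h1
    refine h1.congr_of_eventuallyEq ?_
    filter_upwards [hnear t htWI] with s hs
    exact (hsurf s hs (density f (φ s))).symm
  have hRS : surfaceIntegral (φ t) (reynoldsIntegrand f φ u t) =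
      surfaceIntegral (φ t) (shapeIntegrand f φ u t) := by
    have h1 := surfaceIntegral_reynoldsRate_eq h hχ' hF hδ hχ1' htWI
    rw [hsurf t htWI, hsurf t htWI] at h1
    exact h1
  have hreg' : ∀ ε ∈ Ioc 0 δ, ∀ s ∈ W ∩ I, HasDerivAt (fun r => Jreg f Q ζ ε (φ r))
      (∫ x in Q, shapeIntegrand f φ u s x * weight ζ ε (φ s) x) s := by
    intro ε hε s hs
    have h1 := hasDerivAt_integral_cutoff_mul_weight h hχ' hF hζ hζ0 hζ1 hζsupp hε.1
      (fun s hs x hx hφ => hχ1' s hs x hx (hφ.trans hε.2)) hs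
    rw [(hQint hS s hs ε hε).2]
    refine h1.congr_of_eventuallyEq ?_
    filter_upwards [hnear s hs] with r hr
    exact (hQint hF r hr ε hε).2
  refine ⟨⟨hsint hF, hsint hS, hJ⟩, ⟨hsint hR, hRS ▸ hJ⟩, ?_, hlim hF, ?_, hlim hS⟩
  · filter_upwards [Ioc_mem_nhdsGT hδ] with ε hε
    filter_upwards [hnear t htWI] with s hs
    exact ⟨(hQint hF s hs ε hε).1, (hQint hS s hs ε hε).1, hreg' ε hε s hs⟩
  · rw [hJ.deriv]
    refine (hlim hS).congr' ?_
    filter_upwards [Ioc_mem_nhdsGT hδ] with ε hε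
    exact (hreg' ε hε t htWI).deriv.symm
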